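/- **Setting.** A *network* $\mathcal G=(V,A,\alpha)$ consists of a finite set $V$, a matrix $A:V^2\to[0,\infty)$ and a probability vector $\alpha$ on $V$ with $\alpha>0$. A *motif* on $[k]=\{1,\dots,k\}$ ($k\ge1$) is a matrix $A_F:[k]^2\to[0,\infty)$, written $F=([k],A_F)$; $H+F:=([k],A_H+A_F)$. With $0^0=1$ put $w_F(\mathbf x)=\prod_{i,j}A(\mathbf x(i),\mathbf x(j))^{A_F(i,j)}$ for $\mathbf x:[k]\to V$, and $$\mathtt t(F,\mathcal G)=\sum_{\mathbf x}w_F(\mathbf x)\prod_i\alpha(\mathbf x(i)),\qquad \pi_{F\to\mathcal G}(\mathbf x)=\frac{w_F(\mathbf x)\prod_i\alpha(\mathbf x(i))}{\mathtt t(F,\mathcal G)} .$$ A *homomorphism* $F\to\mathcal G$ is an $\mathbf x$ with $\pi_{F\to\mathcal G}(\mathbf x)>0$. The observables are $\mathtt t(H,\mathcal G|F)=\mathtt t(H+F,\mathcal G)/\mathtt t(F,\mathcal G)$; $\mathtt f(H,\mathcal G|F)(s)=\pi_{F\to\mathcal G}\big(\min_{i,j}A(\mathbf x(i),\mathbf x(j))^{A_H(i,j)}\ge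 s\big)$ for $s\in[0,1]$; and the motif transform matrix $A^{F}(a,b)=\pi_{F\to\mathcal G}(\mathbf x(1)=a,\ \mathbf x(k)=b)$, $a,b\in V$ (taken to be $0$ if $\mathtt t(F,\mathcal G)=0$). $F$ is a *rooted tree motif* if $A_F(j,1)=0$ for all $j$, and for every $i\ge2$ there is exactly one $j=i^-$ with $A_F(j,i)>0$, and $i^-<i$. Let $\Psi(a,b)=\dfrac{\alpha(a)\max(A(a,b),A(b,a))\alpha(b)}{\sum_c\alpha(a)\max(A(a,c),A(c,a))\alpha(c)}$. $\mathcal G$ is *irreducible* if the random walk with kernel $\Psi$ visits, from any node, every node with positive probability. $\mathcal G$ is *bidirectional* if $A(a,b)>0\iff A(b,a)>0$. Its *skeleton* is the simple graph on $V$ in which $a\ne b$ are adjacent iff $\min(A(a,b),A(b,a))>0$. *Pivot chain* (for a rooted tree motif $F$, and $\mathcal G$ such that every $a\in V$ has some $b$ with $A(a,b)>0$): from $\mathbf x_t$ with $\mathbf x_t(1)=a$, propose $b$ with probability $\Psi(a,b)$; set $\mathbf x_{t+1}(1)=b$ with probability $\lambda=\frac{\pi^{(1)}(b)\Psi(b,a)}{\pi^{(1)}(a)\Psi(a,b)}\wedge1$,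 and $\mathbf x_{t+1}(1)=a$ otherwise, where $\pi^{(1)}$ is the law of $\mathbf x(1)$ under $\pi_{F\to\mathcal G}$. Then for $i=2,\dots,k$ in turn sample $\mathbf x_{t+1}(i)$ from the conditional law of $\mathbf x(i)$ under $\pi_{F\to\mathcal G}$ given $\mathbf x(1)=\mathbf x_{t+1}(1),\dots,\mathbf x(i-1)=\mathbf x_{t+1}(i-1)$. *Glauber chain*: choose $i\in[k]$ uniformly, keep $\mathbf x_{t+1}(j)=\mathbf x_t(j)$ for $j\ne i$, and set $\mathbf x_{t+1}(i)=b$ with probability proportional to $\Big(\prod_{j\ne i}A(\mathbf x_t(j),b)^{A_F(j,i)}A(b,\mathbf x_t(j))^{A_F(i,j)}\Big)A(b,b)^{A_F(i,i)}\alpha(b)$. **Statement.** Let $F$ be a rooted tree motif on $[k]$, $H$ any motif on $[k]$, $\mathcal G$ an irreducible network, and $\mathbf x_0:F\to\mathcal G$ any homomorphism. Suppose that every node $a$ of $\mathcal G$ has some $b$ with $A(a,b)>0$, and let $(\mathbf x_t)_{t\ge0}$ be the pivot chain started at $\mathbf x_0$. Then, almost surely, $$\mathtt t(H,\mathcal G|F)=\lim_{N\to\infty}\frac1N\sum_{t=1}^N\prod_{i,j}A(\mathbf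 x_t(i),\mathbf x_t(j))^{A_H(i,j)},$$ $$\mathtt f(H,\mathcal G|F)(s)=\lim_{N\to\infty}\frac1N\sum_{t=1}^N\prod_{i,j}\mathbf 1\big(A(\mathbf x_t(i),\mathbf x_t(j))^{A_H(i,j)}\ge s\big)\quad\text{for all }s\in[0,1],$$ $$\mathtt t(H,\mathcal G|F)\,A^{H+F}=\lim_{N\to\infty}\frac1N\sum_{t=1}^N\Big(\prod_{i,j}A(\mathbf x_t(i),\mathbf x_t(j))^{A_H(i,j)}\Big)E_{\mathbf x_t(1),\mathbf x_t(k)},$$ where $E_{a,b}$ is the $V\times V$ matrix with a single $1$ at $(a,b)$ and zeros elsewhere. If instead $\mathcal G$ is bidirectional and its skeleton contains an odd cycle, the same three limits hold almost surely for the Glauber chain started at $\mathbf x_0$. -/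

import Mathlib

open MeasureTheory Filter Topology

noncomputable section

namespace MotifSampling

/-- A network `(V, A, α)`: nonnegative edge weights `A` and a fully supported probability
vector `α` on the finite node set `V`. -/
structure Network (V : Type*) [Fintype V] where
  A : V → V → ℝ
  α : V → ℝ
  A_nonneg : ∀ a b, 0 ≤ A a b
  α_pos : ∀ a, 0 < α a
  α_sum : ∑ a, α a = 1

/-- A motif with `k = m + 1` nodes. The nodes `1, …, k` are the elements `0, …, m` of
`Fin (m + 1)`; in particular node `1` is `0` and node `k` is `Fin.last m`. -/
structure Motif (m : ℕ) where
  A : Fin (m + 1) → Fin (m + 1) → ℝ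
  A_nonneg : ∀ i j, 0 ≤ A i j

/-- The motif `H + F` on the same node set, with the edge weights added. -/
instance (m : ℕ) : Add (Motif m) where
  add H F := ⟨fun i j => H.A i j + F.A i j, fun i j => add_nonneg (H.A_nonneg i j) (F.A_nonneg i j)⟩

/-- `F` is an edge-weighted directed tree rooted at the first node, without loops: nothing points
to the root, and every other node `i` has exactly one in-neighbour (its parent), which moreover
precedes `i` in the ordering of the nodes. -/
def Motif.IsRootedTree {m : ℕ} (F : Motif m) : Prop :=
  (∀ j, F.A j 0 = 0) ∧
    ∀ i, i ≠ 0 → ∃ j, j < i ∧ 0 < F.A j i ∧ ∀ j', 0 < F.A j' i → j' = j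

section

variable {V : Type*} [Fintype V] {m : ℕ}

/-- `∏_{i,j} A(x(i), x(j)) ^ A_H(i,j)`, with `0 ^ 0 = 1`. -/
def edgeProd (H : Motif m) (G : Network V) (x : Fin (m + 1) → V) : ℝ :=
  ∏ i, ∏ j, G.A (x i) (x j) ^ H.A i j

/-- The homomorphism density `t(F, G)`. -/
def homDensity (F : Motif m) (G : Network V) : ℝ :=
  ∑ x : Fin (m + 1) → V, edgeProd F G x * ∏ i, G.α (x i)

/-- The probability `π_{F → G}(x)`. -/
def homProb (F : Motif m) (G : Network V) (x : Fin (m + 1) → V) : ℝ :=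
  (edgeProd F G x * ∏ i, G.α (x i)) / homDensity F G

/-- A vertex map is a homomorphism `F → G` if `π_{F → G}` charges it. -/
def IsHom (F : Motif m) (G : Network V) (x : Fin (m + 1) → V) : Prop :=
  0 < homProb F G x

/-- The probability of the event `E` under `π_{F → G}`. -/
def homProbOf (F : Motif m) (G : Network V) (E : Set (Fin (m + 1) → V)) : ℝ :=
  ∑ x : Fin (m + 1) → V, E.indicator (homProb F G) x

/-- The conditional homomorphism density `t(H, G | F)` (zero if `t(F, G) = 0`). -/
def condHomDensity (H : Motif m) (G : Network V) (F : Motif m) : ℝ :=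
  homDensity (H + F) G / homDensity F G

/-- The CHD profile `f(H, G | F)`. -/
def chdProfile (H : Motif m) (G : Network V) (F : Motif m) (t : ℝ) : ℝ :=
  homProbOf F G {x | t ≤ Finset.univ.inf' Finset.univ_nonempty
    (fun p : Fin (m + 1) × Fin (m + 1) => G.A (x p.1) (x p.2) ^ H.A p.1 p.2)}

/-- The matrix `A^F` of the motif transform of `G` by `F`: the joint law of the images of the
first and the last node under a random homomorphism `F → G`. -/
def motifTransform (F : Motif m) (G : Network V) : Matrix V V ℝ :=
  Matrix.of fun a b => homProbOf F G {x | x 0 = a ∧ x (Fin.last m) = b}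

/-- The random walk kernel `Ψ` on the network. -/
def walkKernel (G : Network V) (a b : V) : ℝ :=
  (G.α a * max (G.A a b) (G.A b a) * G.α b) /
    ∑ c, G.α a * max (G.A a c) (G.A c a) * G.α c

/-- The random walk with kernel `Ψ`, started anywhere, visits every node with positive
probability. -/
def Network.IsIrreducible [DecidableEq V] (G : Network V) : Prop :=
  ∀ a b, ∃ r : ℕ, 0 < (Matrix.of (walkKernel G) ^ r) a b

/-- Every node has an out-edge. -/
def Network.HasOutEdges (G : Network V) : Prop :=
  ∀ a, ∃ b, 0 < G.A a b

def Network.IsBidirectional (G : Network V) : Prop :=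
  ∀ a b, 0 < G.A a b ↔ 0 < G.A b a

/-- The skeleton: the simple graph in which distinct `a`, `b` are adjacent when
`min (A a b) (A b a) > 0`. -/
def Network.skeleton (G : Network V) : SimpleGraph V where
  Adj a b := a ≠ b ∧ 0 < min (G.A a b) (G.A b a)
  symm := ⟨fun a b h => ⟨h.1.symm, by rw [min_comm]; exact h.2⟩⟩
  loopless := ⟨fun _ h => h.1 rfl⟩

/-- The law `π⁽¹⁾` of the image of the root (the pivot) under `π_{F → G}`. -/
def pivotMarginal (F : Motif m) (G : Network V) (a : V) : ℝ :=
  homProbOf F G {x | x 0 = a}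

/-- The probability `λ` of accepting the proposed move `a ↦ b` of the pivot. -/
def acceptProb (F : Motif m) (G : Network V) (a b : V) : ℝ :=
  min (pivotMarginal F G b / pivotMarginal F G a * (walkKernel G b a / walkKernel G a b)) 1

/-- The kernel of the pivot: a move proposed by `Ψ` is accepted with probability `λ`, and the
pivot stays where it is upon rejection. -/
def pivotMove [DecidableEq V] (F : Motif m) (G : Network V) (a b : V) : ℝ :=
  walkKernel G a b * acceptProb F G a b +
    if b = a then ∑ c, walkKernel G a c * (1 - acceptProb F G a c) else 0

/-- The conditional probability, under `π_{F → G}`, that node `i` is sent to `y i`, given that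
every earlier node `j < i` is sent to `y j`. -/
def nextNodeProb (F : Motif m) (G : Network V) (i : Fin (m + 1)) (y : Fin (m + 1) → V) : ℝ :=
  homProbOf F G {z | ∀ j ≤ i, z j = y j} / homProbOf F G {z | ∀ j < i, z j = y j}

/-- The pivot chain: first the pivot moves, then the other nodes are resampled one by one, each
from its conditional law under `π_{F → G}` given the nodes that are already placed. -/
def pivotKernel [DecidableEq V] (F : Motif m) (G : Network V) (x y : Fin (m + 1) → V) : ℝ :=
  pivotMove F G (x 0) (y 0) * ∏ i ∈ Finset.univ.erase 0, nextNodeProb F G i y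

/-- The unnormalised weight with which node `i` is sent to `b` in an update of node `i`. -/
def glauberWeight (F : Motif m) (G : Network V) (x : Fin (m + 1) → V) (i : Fin (m + 1))
    (b : V) : ℝ :=
  (∏ j ∈ Finset.univ.erase i, G.A (x j) b ^ F.A j i * G.A b (x j) ^ F.A i j) *
    G.A b b ^ F.A i i * G.α b

/-- The Glauber chain: a uniformly chosen node `i` is resampled with probabilities proportional
to `glauberWeight`, the other nodes stay. -/
def glauberKernel [DecidableEq V] (F : Motif m) (G : Network V) (x y : Fin (m + 1) → V) : ℝ :=
  ∑ i, (1 / ((m : ℝ) + 1)) *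
    if ∀ j, j ≠ i → y j = x j then
      glauberWeight F G x i (y i) / ∑ c, glauberWeight F G x i c
    else 0

end

/-- `X` is a Markov chain on the finite set `S` with transition probabilities `K`, started at
`x₀`, given through its finite-dimensional distributions. -/
structure IsMarkovChain {S Ω : Type*} [MeasurableSpace Ω] (μ : Measure Ω) (K : S → S → ℝ)
    (x₀ : S) (X : ℕ → Ω → S) : Prop where
  measurableSet_eq : ∀ t s, MeasurableSet {ω | X t ω = s}
  law : ∀ (T : ℕ) (y : ℕ → S), y 0 = x₀ →
    μ.real {ω | ∀ t ≤ T, X t ω = y t} = ∏ t ∈ Finset.range T, K (y t) (y (t + 1))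

/-- Along the trajectory `x`, the three time averages converge to the three observables. -/
def TimeAveragesConverge {V : Type*} [Fintype V] [DecidableEq V] {m : ℕ} (F H : Motif m)
    (G : Network V) (x : ℕ → Fin (m + 1) → V) : Prop :=
  Tendsto (fun N : ℕ => (1 / (N : ℝ)) * ∑ t ∈ Finset.Icc 1 N, edgeProd H G (x t))
      atTop (𝓝 (condHomDensity H G F)) ∧
  (∀ s ∈ Set.Icc (0 : ℝ) 1,
    Tendsto (fun N : ℕ => (1 / (N : ℝ)) * ∑ t ∈ Finset.Icc 1 N,
        ∏ i, ∏ j, if s ≤ G.A (x t i) (x t j) ^ H.A i j then (1 : ℝ) else 0)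
      atTop (𝓝 (chdProfile H G F s))) ∧
  Tendsto (fun N : ℕ => (1 / (N : ℝ)) • ∑ t ∈ Finset.Icc 1 N,
        edgeProd H G (x t) • Matrix.single (x t 0) (x t (Fin.last m)) (1 : ℝ))
      atTop (𝓝 (condHomDensity H G F • motifTransform (H + F) G))

end MotifSampling

end

open MotifSampling

/-! Each observable is the average under π_{F→G} of a function of the vertex map. Both chains are
reversible with respect to π_{F→G}, and their positive transitions connect any two homomorphisms, so
all limits follow from one strong law for finite reversible chains, `ae_tendsto_average`. Only time
averages occur, so aperiodicity is not needed.

For the strong law, solve the Poisson equation g - Kg = f - π(f) on the support of π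
(`exists_poisson`). The centred sum of f along the path is then a martingale plus a bounded boundary
term. The increments of the martingale M are bounded and orthogonal, so E M_N² = O(N). This gives
M_N/N → 0 almost surely along squares, and bounded increments fill the gaps.

In the pivot chain the root performs a Metropolis walk for its marginal, and the other nodes are
drawn from their conditional law given the root. Reversibility and connectivity thus reduce to the
root, which can take every value because every node has an out-edge.

For the Glauber chain the difficulty is connectivity (`treeMove_connected`): homomorphisms of a tree
into a connected, symmetric, non-bipartite relation must be joined by changes at single nodes.
Leaves are added one at a time: before the parent of the new leaf moves, the leaf is parked on the
image of another neighbour of the parent. On a single edge the root travels along even walks, and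
the odd cycle makes these reach every point. -/

/-! ### The ergodic theorem for reversible Markov chains on a finite set -/

/-- The kernel `K` is stochastic on the support of the probability vector `π`, is reversible with
respect to `π`, and connects any two points of the support of `π`. -/
structure IsReversibleErgodic {S : Type*} [Fintype S] (K : S → S → ℝ) (π : S → ℝ) : Prop where
  nonneg : ∀ x, 0 ≤ π x
  sum_eq_one : ∑ x, π x = 1
  kernel_nonneg : ∀ x y, 0 < π x → 0 ≤ K x y
  row_sum : ∀ x, 0 < π x → ∑ y, K x y = 1
  detailed_balance : ∀ x y, π x * K x y = π y * K y x
  connected : ∀ x y, 0 < π x → 0 < π y → Relation.ReflTransGen (fun a b => 0 < K a b) x y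

namespace IsReversibleErgodic

variable {S : Type*} [Fintype S] {K : S → S → ℝ} {π : S → ℝ}

/-- Mass flowing out of the support would have to flow back, by detailed balance. Hence the
behaviour of `K` off the support, where a kernel may fail to be stochastic, never matters. -/
theorem support_closed (h : IsReversibleErgodic K π) {x y : S} (hx : 0 < π x) (hK : K x y ≠ 0) :
    0 < π y := by
  refine lt_of_le_of_ne (h.nonneg y) fun h0 => ?_
  have := h.detailed_balance x y
  rw [← h0, zero_mul] at this
  exact (mul_ne_zero hx.ne' hK) this

theorem stationary (h : IsReversibleErgodic K π) (g : S → ℝ) :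
    ∑ x, π x * ∑ y, K x y * g y = ∑ y, π y * g y := by
  calc ∑ x, π x * ∑ y, K x y * g y = ∑ x, ∑ y, π y * K y x * g y := by
        refine Finset.sum_congr rfl fun x _ => ?_
        rw [Finset.mul_sum]
        refine Finset.sum_congr rfl fun y _ => ?_
        rw [← mul_assoc, h.detailed_balance x y]
    _ = ∑ y, ∑ x, π y * K y x * g y := Finset.sum_comm
    _ = ∑ y, π y * g y := by
        refine Finset.sum_congr rfl fun y _ => ?_
        rw [← Finset.sum_mul, ← Finset.mul_sum]
        rcases (h.nonneg y).eq_or_lt with h0 | h0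
        · simp [← h0]
        · rw [h.row_sum y h0, mul_one]

/-- A function that is harmonic on the support of `π` is constant there. -/
theorem eq_of_harmonic (h : IsReversibleErgodic K π) (g : S → ℝ)
    (hg : ∀ x, 0 < π x → g x = ∑ y, K x y * g y) {x y : S} (hx : 0 < π x) (hy : 0 < π y) :
    g x = g y := by
  -- Maximum principle: at a maximum point the average of the nonnegative differences `g z - g y`
  -- vanishes, so the maximum spreads along positive transitions.
  obtain ⟨z, hz, hmax⟩ := Finset.exists_max_image (Finset.univ.filter fun x => 0 < π x) g
    ⟨x, by simpa using hx⟩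
  simp only [Finset.mem_filter, Finset.mem_univ, true_and] at hz hmax
  have key : ∀ w, Relation.ReflTransGen (fun a b => 0 < K a b) z w → 0 < π w ∧ g w = g z := by
    intro w hzw
    induction hzw with
    | refl => exact ⟨hz, rfl⟩
    | @tail b c _ hbc ih =>
      obtain ⟨hb, hgb⟩ := ih
      have hc := h.support_closed hb hbc.ne'
      refine ⟨hc, ?_⟩
      have h0 : ∑ y, K b y * (g z - g y) = 0 := by
        simp only [mul_sub, Finset.sum_sub_distrib]
        rw [← Finset.sum_mul, h.row_sum b hb, one_mul, ← hg b hb, hgb, sub_self]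
      rw [Finset.sum_eq_zero_iff_of_nonneg] at h0
      · have := h0 c (Finset.mem_univ _)
        rcases mul_eq_zero.1 this with h1 | h1
        · exact absurd h1 hbc.ne'
        · linarith
      · intro y _
        rcases eq_or_ne (K b y) 0 with h1 | h1
        · simp [h1]
        · exact mul_nonneg (h.kernel_nonneg _ _ hb)
            (sub_nonneg.2 (hmax y (h.support_closed hb h1)))
  rw [(key x (h.connected z x hz hx)).2, (key y (h.connected z y hz hy)).2]

/-- The Poisson equation can be solved on the support of `π`. -/
theorem exists_poisson (h : IsReversibleErgodic K π) (f : S → ℝ) :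
    ∃ g : S → ℝ, ∀ x, 0 < π x → g x - ∑ y, K x y * g y = f x - ∑ y, π y * f y := by
  classical
  -- On the support this is I - K plus the rank-one map g ↦ π(g), which removes the kernel of
  -- constants. Off the support it is the identity, since nothing is known about `K` there.
  let L : (S → ℝ) →ₗ[ℝ] (S → ℝ) :=
    { toFun := fun g x => if 0 < π x then g x - ∑ y, K x y * g y + ∑ y, π y * g y else g x
      map_add' := by
        intro g g'
        funext x
        simp only [Pi.add_apply, mul_add, Finset.sum_add_distrib]
        split_ifs <;> ring
      map_smul' := by
        intro c g
        funext x
        simp only [Pi.smul_apply, smul_eq_mul, mul_left_comm _ c, ← Finset.mul_sum,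
          RingHom.id_apply]
        split_ifs <;> ring }
  have hL : ∀ g x, L g x = if 0 < π x then g x - ∑ y, K x y * g y + ∑ y, π y * g y else g x :=
    fun _ _ => rfl
  -- Since `L` preserves π-means, a solution of `L g = f` has mean π(f), which turns `L g = f` into
  -- the Poisson equation.
  have hmean : ∀ g, ∑ x, π x * L g x = ∑ y, π y * g y := by
    intro g
    have : ∀ x, π x * L g x
        = π x * g x - π x * ∑ y, K x y * g y + π x * ∑ y, π y * g y := by
      intro x
      rw [hL]
      split_ifs with hx
      · ring
      · have : π x = 0 := le_antisymm (not_lt.1 hx) (h.nonneg x)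
        simp [this]
    simp only [this, Finset.sum_add_distrib, Finset.sum_sub_distrib]
    rw [h.stationary, ← Finset.sum_mul, h.sum_eq_one]
    ring
  have hinj : Function.Injective L := by
    rw [← LinearMap.ker_eq_bot, LinearMap.ker_eq_bot']
    intro g hg
    have hm : ∑ y, π y * g y = 0 := by
      rw [← hmean g, hg]; simp
    have hx : ∀ x, 0 < π x → g x = ∑ y, K x y * g y := by
      intro x hx
      have := congrFun hg x
      rw [hL, if_pos hx, hm] at this
      simp only [Pi.zero_apply] at this
      linarith
    funext x
    by_cases hpx : 0 < π x
    · have : ∑ y, π y * g y = ∑ y, π y * g x := by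
        refine Finset.sum_congr rfl fun y _ => ?_
        rcases (h.nonneg y).eq_or_lt with h0 | h0
        · simp [← h0]
        · rw [h.eq_of_harmonic g hx h0 hpx]
      rw [hm, ← Finset.sum_mul, h.sum_eq_one, one_mul] at this
      exact this.symm
    · have := congrFun hg x
      rw [hL, if_neg hpx] at this
      exact this
  obtain ⟨g, hg⟩ := LinearMap.injective_iff_surjective.1 hinj f
  refine ⟨g, fun x hx => ?_⟩
  have h1 := congrFun hg x
  rw [hL, if_pos hx] at h1
  have h2 := hmean g
  rw [hg] at h2
  rw [h2]
  linarith

end IsReversibleErgodic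

/-! ### Path laws, the Poisson martingale and the strong law. -/

namespace MotifSampling.IsMarkovChain

variable {S Ω : Type*} [Fintype S] [MeasurableSpace Ω] {μ : Measure Ω} [IsProbabilityMeasure μ]
  {K : S → S → ℝ} {π : S → ℝ} {x₀ : S} {X : ℕ → Ω → S}

omit [Fintype S] in
theorem ae_zero (hX : IsMarkovChain μ K x₀ X) : ∀ᵐ ω ∂μ, X 0 ω = x₀ := by
  have h := hX.law 0 (fun _ => x₀) rfl
  simp only [Nat.le_zero, forall_eq, Finset.range_zero, Finset.prod_empty] at h
  rw [measureReal_def, ENNReal.toReal_eq_one_iff] at h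
  exact (prob_compl_eq_zero_iff (hX.measurableSet_eq 0 x₀)).2 h

-- The law of the chain is prescribed only for paths from `x₀`; this covers the others, so that
-- `path_succ` holds for every path.
omit [Fintype S] in
theorem path_eq_zero (hX : IsMarkovChain μ K x₀ X) (n : ℕ) (y : ℕ → S) (hy : y 0 ≠ x₀) :
    μ.real {ω | ∀ t ≤ n, X t ω = y t} = 0 := by
  rw [measureReal_def, measure_eq_zero_iff_ae_notMem.2, ENNReal.toReal_zero]
  filter_upwards [hX.ae_zero] with ω hω hmem
  exact hy ((hmem 0 (Nat.zero_le _)).symm.trans hω)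

omit [Fintype S] in
theorem path_succ (hX : IsMarkovChain μ K x₀ X) (n : ℕ) (y : ℕ → S) :
    μ.real {ω | ∀ t ≤ n + 1, X t ω = y t}
      = μ.real {ω | ∀ t ≤ n, X t ω = y t} * K (y n) (y (n + 1)) := by
  by_cases hy : y 0 = x₀
  · rw [hX.law _ y hy, hX.law _ y hy, Finset.prod_range_succ]
  · rw [hX.path_eq_zero _ y hy, hX.path_eq_zero _ y hy, zero_mul]

theorem support_of_path_ne_zero (hX : IsMarkovChain μ K x₀ X) (h : IsReversibleErgodic K π)
    (hx₀ : 0 < π x₀) (n : ℕ) (y : ℕ → S) (hy : μ.real {ω | ∀ t ≤ n, X t ω = y t} ≠ 0) :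
    0 < π (y n) := by
  induction n with
  | zero =>
    by_cases h0 : y 0 = x₀
    · rwa [h0]
    · exact absurd (hX.path_eq_zero 0 y h0) hy
  | succ n ih =>
    rw [hX.path_succ] at hy
    exact h.support_closed (ih (left_ne_zero_of_mul hy)) (right_ne_zero_of_mul hy)

omit [Fintype S] [MeasurableSpace Ω] in
theorem setOf_path_eq {n : ℕ} {p : Fin (n + 1) → S} {y : ℕ → S}
    (hy : ∀ i : Fin (n + 1), y i = p i) :
    {ω | ∀ i : Fin (n + 1), X i ω = p i} = {ω | ∀ t ≤ n, X t ω = y t} := by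
  ext ω
  constructor
  · intro h t ht
    exact (h ⟨t, by omega⟩).trans (hy ⟨t, by omega⟩).symm
  · intro h i
    exact (h i (by omega)).trans (hy i)

/-- The expectation of a function of the path up to time `n + 1`. -/
theorem integral_path (hX : IsMarkovChain μ K x₀ X) (n : ℕ)
    (Φ : (Fin (n + 1) → S) → S → ℝ) :
    ∫ ω, Φ (fun i => X i ω) (X (n + 1) ω) ∂μ
      = ∑ p : Fin (n + 1) → S, ∑ s,
        μ.real {ω | ∀ i : Fin (n + 1), X i ω = p i} * K (p (Fin.last n)) s * Φ p s := by
  let _ : MeasurableSpace S := ⊤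
  have hmeas : ∀ t, Measurable (X t) := fun t =>
    measurable_to_countable' fun s => hX.measurableSet_eq t s
  let Y : Ω → (Fin (n + 1) → S) × S := fun ω => (fun i => X i ω, X (n + 1) ω)
  have hY : Measurable Y := (measurable_pi_lambda _ fun i : Fin (n + 1) => hmeas i).prodMk (hmeas (n + 1))
  have h1 : ∫ ω, Φ (fun i => X i ω) (X (n + 1) ω) ∂μ
      = ∫ z, Φ z.1 z.2 ∂(μ.map Y) := by
    rw [integral_map hY.aemeasurable (measurable_of_finite _).aestronglyMeasurable]
  have : IsProbabilityMeasure (μ.map Y) := Measure.isProbabilityMeasure_map hY.aemeasurable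
  rw [h1, integral_fintype (Integrable.of_finite), Fintype.sum_prod_type]
  refine Finset.sum_congr rfl fun p _ => Finset.sum_congr rfl fun s _ => ?_
  rw [map_measureReal_apply hY (measurableSet_singleton _), smul_eq_mul]
  congr 1
  -- The law is stated for infinite sequences, so the finite path is continued by the constant `s`;
  -- only its value at time `n + 1` matters.
  let y : ℕ → S := fun t => if ht : t < n + 1 then p ⟨t, ht⟩ else s
  have hy : ∀ i : Fin (n + 1), y i = p i := fun i => dif_pos i.2
  have e1 : Y ⁻¹' {(p, s)} = {ω | ∀ t ≤ n + 1, X t ω = y t} := by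
    ext ω
    simp only [Set.mem_preimage, Set.mem_singleton_iff, Y, Prod.mk.injEq, Set.mem_ofPred_eq]
    constructor
    · rintro ⟨h1, h2⟩ t ht
      by_cases htn : t < n + 1
      · simp only [y, dif_pos htn]
        exact congrFun h1 ⟨t, htn⟩
      · have : t = n + 1 := by omega
        subst this
        simpa [y] using h2
    · intro h
      refine ⟨funext fun i => ?_, ?_⟩
      · exact (h i (by omega)).trans (hy i)
      · have := h (n + 1) le_rfl
        simpa [y] using this
  have e2 := setOf_path_eq (X := X) hy
  rw [e1, e2, hX.path_succ]
  have hn : y n = p (Fin.last n) := by simp [y, Fin.last]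
  have hn1 : y (n + 1) = s := by simp [y]
  rw [hn, hn1]

theorem ae_support (hX : IsMarkovChain μ K x₀ X) (h : IsReversibleErgodic K π)
    (hx₀ : 0 < π x₀) : ∀ᵐ ω ∂μ, ∀ t, 0 < π (X t ω) := by
  rw [ae_all_iff]
  intro t
  have hz : ∀ p : Fin (t + 1) → S, ¬ 0 < π (p (Fin.last t)) →
      μ {ω | ∀ i : Fin (t + 1), X i ω = p i} = 0 := by
    intro p hp
    let y : ℕ → S := fun t' => if ht : t' < t + 1 then p ⟨t', ht⟩ else x₀
    have e2 := setOf_path_eq (X := X) (y := y) fun i => dif_pos i.2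
    have hn : y t = p (Fin.last t) := by simp [y, Fin.last]
    by_contra hne
    apply hp
    rw [← hn]
    refine hX.support_of_path_ne_zero h hx₀ t y ?_
    rw [← e2, measureReal_def]
    exact (ENNReal.toReal_pos hne (measure_ne_top _ _)).ne'
  have : ∀ᵐ ω ∂μ, ∀ p : Fin (t + 1) → S, ¬ 0 < π (p (Fin.last t)) →
      ¬ ∀ i : Fin (t + 1), X i ω = p i := by
    rw [ae_all_iff]
    intro p
    by_cases hp : 0 < π (p (Fin.last t))
    · exact Eventually.of_forall fun ω h => absurd hp h
    · filter_upwards [measure_eq_zero_iff_ae_notMem.1 (hz p hp)] with ω hω _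
      exact hω
  filter_upwards [this] with ω hω
  by_contra hc
  exact hω (fun i => X i ω) (by simpa using hc) fun _ => rfl

/-- Martingale increments are orthogonal to functions of the past. -/
theorem integral_mul_increment (hX : IsMarkovChain μ K x₀ X) (h : IsReversibleErgodic K π)
    (hx₀ : 0 < π x₀) (n : ℕ) (Φ : (Fin (n + 1) → S) → ℝ) (g : S → ℝ) :
    ∫ ω, Φ (fun i => X i ω) * (g (X (n + 1) ω) - ∑ y, K (X n ω) y * g y) ∂μ = 0 := by
  have := hX.integral_path n fun p s => Φ p * (g s - ∑ y, K (p (Fin.last n)) y * g y)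
  simp only [Fin.val_last] at this
  rw [this]
  refine Finset.sum_eq_zero fun p _ => ?_
  by_cases hp : μ.real {ω | ∀ i : Fin (n + 1), X i ω = p i} = 0
  · simp [hp]
  have hpos : 0 < π (p (Fin.last n)) := by
    by_contra hc
    apply hp
    rw [measureReal_def, measure_eq_zero_iff_ae_notMem.2, ENNReal.toReal_zero]
    filter_upwards [hX.ae_support h hx₀] with ω hω hmem
    apply hc
    rw [← hmem (Fin.last n)]
    exact hω _
  have e : ∀ s, μ.real {ω | ∀ i : Fin (n + 1), X i ω = p i} * K (p (Fin.last n)) s *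
      (Φ p * (g s - ∑ y, K (p (Fin.last n)) y * g y))
      = μ.real {ω | ∀ i : Fin (n + 1), X i ω = p i} * Φ p *
        (K (p (Fin.last n)) s * g s - K (p (Fin.last n)) s * ∑ y, K (p (Fin.last n)) y * g y) :=
    fun s => by ring
  simp only [e]
  rw [← Finset.mul_sum, Finset.sum_sub_distrib, ← Finset.sum_mul, h.row_sum _ hpos]
  ring

/-- The martingale attached to `g` and the kernel `K`, along the path `x`. -/
noncomputable def pathMartingale (K : S → S → ℝ) (g : S → ℝ) (x : ℕ → S) (n : ℕ) : ℝ :=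
  ∑ t ∈ Finset.range n, (g (x (t + 1)) - ∑ y, K (x t) y * g y)

theorem abs_pathMartingale_sub_le {C : ℝ} {g : S → ℝ}
    (hC : ∀ x y, |g y - ∑ z, K x z * g z| ≤ C) (x : ℕ → S) (n k : ℕ) :
    |pathMartingale K g x (n + k) - pathMartingale K g x n| ≤ C * k := by
  induction k with
  | zero => simp
  | succ k ih =>
    have : pathMartingale K g x (n + (k + 1)) - pathMartingale K g x n
        = (pathMartingale K g x (n + k) - pathMartingale K g x n)
          + (g (x (n + k + 1)) - ∑ z, K (x (n + k)) z * g z) := by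
      rw [pathMartingale, ← add_assoc, Finset.sum_range_succ, ← pathMartingale]
      ring
    rw [this]
    refine (abs_add_le _ _).trans ?_
    push_cast
    have := hC (x (n + k)) (x (n + k + 1))
    linarith

omit [IsProbabilityMeasure μ] in
theorem measurable_comp {β : Type*} [MeasurableSpace β] (hX : IsMarkovChain μ K x₀ X) (t : ℕ)
    (f : S → β) : Measurable fun ω => f (X t ω) := by
  let _ : MeasurableSpace S := ⊤
  have hmeas : Measurable (X t) := measurable_to_countable' fun s => hX.measurableSet_eq t s
  exact (measurable_of_finite f).comp hmeas

omit [IsProbabilityMeasure μ] in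
theorem measurable_pathMartingale (hX : IsMarkovChain μ K x₀ X) (g : S → ℝ) (n : ℕ) :
    Measurable fun ω => pathMartingale K g (fun t => X t ω) n := by
  unfold pathMartingale
  exact Finset.measurable_sum _ fun t _ =>
    (hX.measurable_comp (t + 1) g).sub (hX.measurable_comp t fun s => ∑ y, K s y * g y)

theorem integrable_sq_pathMartingale (hX : IsMarkovChain μ K x₀ X) {C : ℝ} {g : S → ℝ}
    (hC : ∀ x y, |g y - ∑ z, K x z * g z| ≤ C) (n : ℕ) :
    Integrable (fun ω => pathMartingale K g (fun t => X t ω) n ^ 2) μ := by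
  refine Integrable.of_bound ((hX.measurable_pathMartingale g n).pow_const 2).aestronglyMeasurable
    ((C * n) ^ 2) (Eventually.of_forall fun ω => ?_)
  have := abs_pathMartingale_sub_le hC (fun t => X t ω) 0 n
  simp only [zero_add, pathMartingale, Finset.range_zero, Finset.sum_empty, sub_zero] at this
  rw [Real.norm_eq_abs, abs_pow]
  exact pow_le_pow_left₀ (abs_nonneg _) this 2

/-- Each increment is orthogonal to the sum of the earlier ones, so the cross term vanishes and
every step adds at most `C ^ 2`. -/
theorem integral_sq_pathMartingale_le (hX : IsMarkovChain μ K x₀ X)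
    (h : IsReversibleErgodic K π) (hx₀ : 0 < π x₀) {C : ℝ} {g : S → ℝ}
    (hC : ∀ x y, |g y - ∑ z, K x z * g z| ≤ C) (n : ℕ) :
    ∫ ω, pathMartingale K g (fun t => X t ω) n ^ 2 ∂μ ≤ C ^ 2 * n := by
  induction n with
  | zero => simp [pathMartingale]
  | succ n ih =>
    set M : Ω → ℝ := fun ω => pathMartingale K g (fun t => X t ω) n with hM
    set D : Ω → ℝ := fun ω => g (X (n + 1) ω) - ∑ y, K (X n ω) y * g y with hD
    have hDm : Measurable D :=
      (hX.measurable_comp (n + 1) g).sub (hX.measurable_comp n fun s => ∑ y, K s y * g y)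
    have hMm : Measurable M := hX.measurable_pathMartingale g n
    have hMb : ∀ ω, |M ω| ≤ C * n := fun ω => by
      have := abs_pathMartingale_sub_le hC (fun t => X t ω) 0 n
      rwa [zero_add, pathMartingale, pathMartingale, Finset.sum_range_zero, sub_zero] at this
    have hMD : ∫ ω, M ω * D ω ∂μ = 0 := by
      -- The martingale at time `n`, written as a function of the path up to time `n`.
      have := hX.integral_mul_increment h hx₀ n
        (fun p => ∑ t : Fin n, (g (p t.succ) - ∑ y, K (p t.castSucc) y * g y)) g
      rw [← this]
      congr 1
      funext ω
      simp only [hM, hD, pathMartingale]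
      rw [Finset.sum_range]
      simp
    have hiM : Integrable (fun ω => M ω ^ 2) μ := hX.integrable_sq_pathMartingale hC n
    have hiMD : Integrable (fun ω => M ω * D ω) μ := by
      refine Integrable.of_bound (hMm.mul hDm).aestronglyMeasurable (C * n * C)
        (Eventually.of_forall fun ω => ?_)
      rw [Real.norm_eq_abs, abs_mul]
      exact mul_le_mul (hMb ω) (hC _ _) (abs_nonneg _) ((abs_nonneg _).trans (hMb ω))
    have hDb : ∀ ω, D ω ^ 2 ≤ C ^ 2 := fun ω => by
      rw [← sq_abs]
      exact pow_le_pow_left₀ (abs_nonneg _) (hC _ _) 2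
    have hiD : Integrable (fun ω => D ω ^ 2) μ := by
      refine Integrable.of_bound (hDm.pow_const 2).aestronglyMeasurable (C ^ 2)
        (Eventually.of_forall fun ω => ?_)
      rw [Real.norm_eq_abs, abs_of_nonneg (sq_nonneg _)]
      exact hDb ω
    have hexp : ∀ ω, pathMartingale K g (fun t => X t ω) (n + 1) ^ 2
        = M ω ^ 2 + 2 * (M ω * D ω) + D ω ^ 2 := fun ω => by
      simp only [hM, hD, pathMartingale, Finset.sum_range_succ]
      ring
    simp only [hexp]
    rw [integral_add (by exact hiM.add (hiMD.const_mul 2)) hiD, integral_add hiM (hiMD.const_mul 2),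
      integral_const_mul, hMD]
    have : ∫ ω, D ω ^ 2 ∂μ ≤ C ^ 2 := by
      calc ∫ ω, D ω ^ 2 ∂μ ≤ ∫ _, C ^ 2 ∂μ := integral_mono hiD (integrable_const _) hDb
        _ = C ^ 2 := by simp
    push_cast
    linarith

theorem ae_tendsto_pathMartingale (hX : IsMarkovChain μ K x₀ X)
    (h : IsReversibleErgodic K π) (hx₀ : 0 < π x₀) (g : S → ℝ) :
    ∀ᵐ ω ∂μ, Tendsto (fun N : ℕ => pathMartingale K g (fun t => X t ω) N / N) atTop (𝓝 0) := by
  obtain ⟨C, hC⟩ : ∃ C, ∀ x y, |g y - ∑ z, K x z * g z| ≤ C := by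
    obtain ⟨C, hC⟩ := Finite.exists_le fun p : S × S => |g p.2 - ∑ z, K p.1 z * g z|
    exact ⟨C, fun x y => hC (x, y)⟩
  have hC0 : 0 ≤ C := (abs_nonneg _).trans (hC x₀ x₀)
  set M : ℕ → Ω → ℝ := fun n ω => pathMartingale K g (fun t => X t ω) n with hM
  -- Along squares the second moments are at most C²/n², which is summable; so the series of squares
  -- is almost surely finite and its terms tend to zero.
  have hsq : ∀ᵐ ω ∂μ, Tendsto (fun n : ℕ => (M (n ^ 2) ω / (n : ℝ) ^ 2) ^ 2) atTop (𝓝 0) := by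
    set Z : ℕ → Ω → ℝ := fun n ω => (M (n ^ 2) ω / (n : ℝ) ^ 2) ^ 2 with hZ
    have hZi : ∀ n, Integrable (Z n) μ := fun n => by
      have := (hX.integrable_sq_pathMartingale hC (n ^ 2)).div_const (((n : ℝ) ^ 2) ^ 2)
      simpa only [hZ, div_pow] using this
    have hZb : ∀ n : ℕ, ∫ ω, Z n ω ∂μ ≤ C ^ 2 * (1 / (n : ℝ) ^ 2) := fun n => by
      simp only [hZ, div_pow]
      rw [integral_div]
      have := hX.integral_sq_pathMartingale_le h hx₀ hC (n ^ 2)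
      rcases Nat.eq_zero_or_pos n with rfl | hn
      · simp
      have hn' : (0 : ℝ) < n := by exact_mod_cast hn
      rw [div_le_iff₀ (by positivity)]
      refine this.trans (le_of_eq ?_)
      push_cast
      field_simp
    have hfin : ∑' n, ∫⁻ ω, ENNReal.ofReal (Z n ω) ∂μ ≠ ⊤ := by
      have hle : ∀ n : ℕ, ∫⁻ ω, ENNReal.ofReal (Z n ω) ∂μ
          ≤ ENNReal.ofReal (C ^ 2 * (1 / (n : ℝ) ^ 2)) := fun n => by
        rw [← ofReal_integral_eq_lintegral_ofReal (hZi n)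
          (Eventually.of_forall fun ω => sq_nonneg _)]
        exact ENNReal.ofReal_le_ofReal (hZb n)
      refine ne_top_of_le_ne_top ?_ (ENNReal.tsum_le_tsum hle)
      exact ((Real.summable_one_div_nat_pow.2 one_lt_two).mul_left _).tsum_ofReal_ne_top
    rw [← lintegral_tsum fun n => (hZi n).1.aemeasurable.ennreal_ofReal] at hfin
    have := ae_lt_top' (AEMeasurable.tsum fun n =>
      (hZi n).1.aemeasurable.ennreal_ofReal) hfin
    filter_upwards [this] with ω hω
    have ht := ENNReal.tendsto_atTop_zero_of_tsum_ne_top hω.ne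
    have ht2 := (ENNReal.tendsto_toReal ENNReal.zero_ne_top).comp ht
    refine ht2.congr fun n => ?_
    simp only [Function.comp]
    exact ENNReal.toReal_ofReal (sq_nonneg _)
  filter_upwards [hsq] with ω hω
  have h1 : Tendsto (fun n : ℕ => |M (n ^ 2) ω / (n : ℝ) ^ 2|) atTop (𝓝 0) := by
    have := hω.sqrt
    simpa only [Real.sqrt_sq_eq_abs, Real.sqrt_zero] using this
  have hs : Tendsto Nat.sqrt atTop atTop := by
    exact tendsto_atTop.2 fun b => (eventually_ge_atTop (b ^ 2)).mono fun N hN => Nat.le_sqrt'.2 hN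
  -- Between n² and (n+1)² there are at most 2n further steps, which change the martingale by at
  -- most 2nC; divided by n² this is the error 2C/n.
  have h2 : Tendsto (fun n : ℕ => |M (n ^ 2) ω / (n : ℝ) ^ 2| + C * 2 * (1 / (n : ℝ)))
      atTop (𝓝 0) := by
    have := h1.add (tendsto_one_div_atTop_nhds_zero_nat.const_mul (C * 2))
    simpa using this
  refine squeeze_zero_norm' ?_ (h2.comp hs)
  filter_upwards [eventually_ge_atTop 1] with N hN
  set n := Nat.sqrt N with hn
  have hn1 : 1 ≤ n := Nat.le_sqrt.2 (by omega)
  have hlo : n ^ 2 ≤ N := Nat.sqrt_le' N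
  have hhi : N ≤ n ^ 2 + 2 * n := by
    have := Nat.sqrt_le_add N
    rw [← hn] at this
    nlinarith
  obtain ⟨k, hk⟩ := Nat.exists_eq_add_of_le hlo
  have hk2 : k ≤ 2 * n := by omega
  have hinc := abs_pathMartingale_sub_le hC (fun t => X t ω) (n ^ 2) k
  rw [← hk] at hinc
  have hn' : (1 : ℝ) ≤ n := by exact_mod_cast hn1
  have hN' : (n : ℝ) ^ 2 ≤ N := by exact_mod_cast hlo
  have hNpos : (0 : ℝ) < (n : ℝ) ^ 2 := by positivity
  have habs : |M N ω| ≤ |M (n ^ 2) ω| + C * (2 * n) := by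
    have h3 : |M N ω| ≤ |M N ω - M (n ^ 2) ω| + |M (n ^ 2) ω| := by
      linarith [abs_sub_abs_le_abs_sub (M N ω) (M (n ^ 2) ω)]
    have h4 : C * (k : ℝ) ≤ C * (2 * n) :=
      mul_le_mul_of_nonneg_left (by exact_mod_cast hk2) hC0
    have h5 : |M N ω - M (n ^ 2) ω| ≤ C * k := hinc
    linarith
  simp only [Function.comp, ← hn]
  rw [Real.norm_eq_abs, abs_div, Nat.abs_cast, abs_div, abs_of_pos hNpos]
  calc |M N ω| / N ≤ (|M (n ^ 2) ω| + C * (2 * n)) / N := by gcongr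
    _ ≤ (|M (n ^ 2) ω| + C * (2 * n)) / (n : ℝ) ^ 2 := by
        apply div_le_div_of_nonneg_left _ hNpos hN'
        positivity
    _ = |M (n ^ 2) ω| / (n : ℝ) ^ 2 + C * 2 * (1 / (n : ℝ)) := by
        field_simp

/-- The ergodic theorem: almost surely, all time averages converge to the averages under the
stationary law. -/
theorem ae_tendsto_average (hX : IsMarkovChain μ K x₀ X)
    (h : IsReversibleErgodic K π) (hx₀ : 0 < π x₀) :
    ∀ᵐ ω ∂μ, ∀ f : S → ℝ, Tendsto (fun N : ℕ => (1 / (N : ℝ)) * ∑ t ∈ Finset.Icc 1 N, f (X t ω))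
      atTop (𝓝 (∑ x, π x * f x)) := by
  classical
  have single : ∀ f : S → ℝ, ∀ᵐ ω ∂μ,
      Tendsto (fun N : ℕ => (1 / (N : ℝ)) * ∑ t ∈ Finset.Icc 1 N, f (X t ω))
        atTop (𝓝 (∑ x, π x * f x)) := by
    intro f
    obtain ⟨g, hg⟩ := h.exists_poisson f
    obtain ⟨B, hB⟩ := Finite.exists_le fun x => |∑ y, K x y * g y|
    filter_upwards [hX.ae_support h hx₀, hX.ae_tendsto_pathMartingale h hx₀ g] with ω hs hm
    -- By the Poisson equation, f(X_t) - π(f) = [g(X_t) - Kg(X_{t-1})] + [Kg(X_{t-1}) - Kg(X_t)];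
    -- the first brackets sum to the martingale and the second telescope.
    have hdec : ∀ N : ℕ, ∑ t ∈ Finset.Icc 1 N, f (X t ω)
        = N * ∑ x, π x * f x + pathMartingale K g (fun t => X t ω) N
          + (∑ y, K (X 0 ω) y * g y - ∑ y, K (X N ω) y * g y) := by
      intro N
      induction N with
      | zero => simp [pathMartingale]
      | succ N ih =>
        rw [Finset.sum_Icc_succ_top (by omega), ih, pathMartingale, pathMartingale,
          Finset.sum_range_succ]
        have := hg _ (hs (N + 1))
        push_cast
        linarith
    have hb : Tendsto (fun N : ℕ => (∑ y, K (X 0 ω) y * g y - ∑ y, K (X N ω) y * g y) / (N : ℝ))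
        atTop (𝓝 0) := by
      refine squeeze_zero_norm (a := fun N : ℕ => (2 * B) * (1 / (N : ℝ))) (fun N => ?_) ?_
      · rw [Real.norm_eq_abs, abs_div, Nat.abs_cast, mul_one_div]
        gcongr
        refine (abs_sub _ _).trans ?_
        have h1 := hB (X 0 ω)
        have h2 := hB (X N ω)
        linarith
      · simpa using tendsto_one_div_atTop_nhds_zero_nat.const_mul (2 * B)
    have hsum := (hm.add hb).const_add (∑ x, π x * f x)
    simp only [add_zero] at hsum
    refine hsum.congr' ?_
    filter_upwards [eventually_ge_atTop 1] with N hN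
    have hN' : (N : ℝ) ≠ 0 := by positivity
    rw [hdec]
    field_simp
    ring
  -- One null set must serve all `f`, as the profile has uncountably many thresholds. By linearity
  -- the finitely many point indicators suffice.
  have hall := ae_all_iff.2 fun s : S => single fun x => if x = s then 1 else 0
  filter_upwards [hall] with ω hω f
  have hlim := tendsto_finsetSum Finset.univ fun s (_ : s ∈ Finset.univ) =>
    (hω s).mul_const (f s)
  simp only [mul_ite, mul_one, mul_zero, Finset.sum_ite_eq', Finset.mem_univ, if_true] at hlim
  refine hlim.congr fun N => ?_
  simp only [mul_assoc, ← Finset.mul_sum]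
  congr 1
  simp only [Finset.sum_mul]
  rw [Finset.sum_comm]
  refine Finset.sum_congr rfl fun t _ => ?_
  simp

end MotifSampling.IsMarkovChain

namespace MotifSampling

section

variable {V : Type*} [Fintype V] {m : ℕ} {F H : Motif m} {G : Network V}

/-! ### Homomorphisms and the observables -/

theorem edgeProd_nonneg (F : Motif m) (G : Network V) (x : Fin (m + 1) → V) :
    0 ≤ edgeProd F G x :=
  Finset.prod_nonneg fun _ _ => Finset.prod_nonneg fun _ _ => Real.rpow_nonneg (G.A_nonneg _ _) _

theorem edgeProd_pos_iff (F : Motif m) (G : Network V) (x : Fin (m + 1) → V) :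
    0 < edgeProd F G x ↔ ∀ i j, 0 < F.A i j → 0 < G.A (x i) (x j) := by
  rw [(edgeProd_nonneg F G x).lt_iff_ne', edgeProd]
  simp only [Finset.prod_ne_zero_iff, Finset.mem_univ, true_imp_iff]
  refine forall₂_congr fun i j => ?_
  rw [Ne, Real.rpow_eq_zero_iff_of_nonneg (G.A_nonneg _ _), not_and',
    (G.A_nonneg _ _).lt_iff_ne', (F.A_nonneg i j).lt_iff_ne']

theorem edgeProd_add (H F : Motif m) (G : Network V) (x : Fin (m + 1) → V) :
    edgeProd (H + F) G x = edgeProd H G x * edgeProd F G x := by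
  simp only [edgeProd, ← Finset.prod_mul_distrib]
  refine Finset.prod_congr rfl fun i _ => Finset.prod_congr rfl fun j _ => ?_
  exact Real.rpow_add_of_nonneg (G.A_nonneg _ _) (H.A_nonneg _ _) (F.A_nonneg _ _)

theorem prod_α_pos (G : Network V) (x : Fin (m + 1) → V) : 0 < ∏ i, G.α (x i) :=
  Finset.prod_pos fun _ _ => G.α_pos _

theorem homDensity_nonneg (F : Motif m) (G : Network V) : 0 ≤ homDensity F G :=
  Finset.sum_nonneg fun _ _ => mul_nonneg (edgeProd_nonneg _ _ _) (prod_α_pos _ _).le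

theorem homProb_nonneg (F : Motif m) (G : Network V) (x : Fin (m + 1) → V) :
    0 ≤ homProb F G x :=
  div_nonneg (mul_nonneg (edgeProd_nonneg _ _ _) (prod_α_pos _ _).le) (homDensity_nonneg _ _)

theorem IsHom.homDensity_pos {x : Fin (m + 1) → V} (hx : IsHom F G x) : 0 < homDensity F G := by
  refine lt_of_le_of_ne (homDensity_nonneg _ _) fun h => ?_
  rw [IsHom, homProb, ← h, div_zero] at hx
  exact lt_irrefl _ hx

theorem isHom_iff (h : 0 < homDensity F G) (x : Fin (m + 1) → V) :
    IsHom F G x ↔ ∀ i j, 0 < F.A i j → 0 < G.A (x i) (x j) := by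
  rw [← edgeProd_pos_iff, IsHom, homProb, div_pos_iff_of_pos_right h,
    mul_pos_iff_of_pos_right (prod_α_pos _ _)]

theorem sum_homProb (h : 0 < homDensity F G) : ∑ x, homProb F G x = 1 := by
  simp only [homProb]
  rw [← Finset.sum_div]
  exact div_self h.ne'

theorem sum_homProb_mul_edgeProd (H F : Motif m) (G : Network V) :
    ∑ x, homProb F G x * edgeProd H G x = condHomDensity H G F := by
  rw [condHomDensity, homDensity, Finset.sum_div]
  refine Finset.sum_congr rfl fun x _ => ?_
  rw [homProb, edgeProd_add]
  ring

open Classical in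
theorem sum_homProb_mul_indicator (H F : Motif m) (G : Network V) (s : ℝ) :
    ∑ x, homProb F G x * ∏ i, ∏ j, (if s ≤ G.A (x i) (x j) ^ H.A i j then (1 : ℝ) else 0)
      = chdProfile H G F s := by
  rw [chdProfile, homProbOf]
  refine Finset.sum_congr rfl fun x _ => ?_
  rw [Set.indicator_apply]
  simp only [Set.mem_ofPred_eq, Finset.le_inf'_iff, Finset.mem_univ, true_imp_iff, Prod.forall]
  split_ifs with h
  · simp [h]
  · obtain ⟨i, hi⟩ := not_forall.1 h
    rw [Finset.prod_eq_zero (Finset.mem_univ i), mul_zero]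
    obtain ⟨j, hj⟩ := not_forall.1 hi
    exact Finset.prod_eq_zero (Finset.mem_univ j) (if_neg hj)

-- The normaliser t(H+F, G) cancels between the two factors on the right. If it is zero, both sides
-- vanish term by term.
open Classical in
theorem sum_homProb_mul_transform (H F : Motif m) (G : Network V) (a b : V) :
    ∑ x, homProb F G x * (edgeProd H G x * if x 0 = a ∧ x (Fin.last m) = b then 1 else 0)
      = condHomDensity H G F * motifTransform (H + F) G a b := by
  have hdom : homDensity (H + F) G = 0 → ∀ x, homProb F G x * edgeProd H G x = 0 := by
    intro h x
    have hz := (Finset.sum_eq_zero_iff_of_nonneg fun x _ =>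
      mul_nonneg (edgeProd_nonneg _ _ _) (prod_α_pos _ _).le).1 h x (Finset.mem_univ x)
    rw [mul_eq_zero, or_iff_left (prod_α_pos _ _).ne', edgeProd_add] at hz
    rw [homProb, div_mul_eq_mul_div, mul_right_comm, mul_comm (edgeProd F G x), hz]
    simp
  simp only [motifTransform, Matrix.of_apply, homProbOf, Set.indicator_apply, Set.mem_ofPred_eq]
  rw [Finset.mul_sum]
  refine Finset.sum_congr rfl fun x _ => ?_
  rw [← mul_assoc]
  split_ifs with hx
  · by_cases h : homDensity (H + F) G = 0
    · rw [hdom h, condHomDensity, h]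
      simp
    · rw [condHomDensity, homProb, homProb, edgeProd_add]
      field_simp
  · simp

/-- Convergence of all time averages to the averages under `π_{F → G}` yields the three limits. -/
theorem timeAveragesConverge_of_tendsto [DecidableEq V] (H : Motif m)
    {x : ℕ → Fin (m + 1) → V}
    (hx : ∀ f : (Fin (m + 1) → V) → ℝ, Tendsto
      (fun N : ℕ => (1 / (N : ℝ)) * ∑ t ∈ Finset.Icc 1 N, f (x t))
      atTop (𝓝 (∑ y, homProb F G y * f y))) :
    TimeAveragesConverge F H G x := by
  refine ⟨?_, fun s _ => ?_, ?_⟩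
  · rw [← sum_homProb_mul_edgeProd]
    exact hx _
  · rw [← sum_homProb_mul_indicator]
    exact hx _
  · refine tendsto_pi_nhds.2 fun a => tendsto_pi_nhds.2 fun b => ?_
    rw [Matrix.smul_apply, smul_eq_mul, ← sum_homProb_mul_transform]
    refine (hx _).congr fun N => ?_
    rw [Matrix.smul_apply, smul_eq_mul, Matrix.sum_apply]
    congr 1
    refine Finset.sum_congr rfl fun t _ => ?_
    rw [Matrix.smul_apply, smul_eq_mul, Matrix.single_apply]
    congr

/-! ### Rooted tree motifs -/

theorem Motif.IsRootedTree.exists_parent (hF : F.IsRootedTree) :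
    ∃ par : Fin (m + 1) → Fin (m + 1), (∀ i, i ≠ 0 → par i < i) ∧
      ∀ i j, 0 < F.A j i ↔ i ≠ 0 ∧ j = par i := by
  classical
  have h := hF.2
  choose! par h1 h2 h3 using h
  refine ⟨par, h1, fun i j => ⟨fun hji => ?_, ?_⟩⟩
  · have hi : i ≠ 0 := by
      rintro rfl
      rw [hF.1 j] at hji
      exact lt_irrefl _ hji
    exact ⟨hi, h3 i hi j hji⟩
  · rintro ⟨hi, rfl⟩
    exact h2 i hi

/-- A root image extends to a homomorphism when every node of the network has an out-edge. -/
theorem exists_hom_of_hasOutEdges (hF : F.IsRootedTree) (hout : G.HasOutEdges) (a : V) :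
    ∃ x : Fin (m + 1) → V, x 0 = a ∧ ∀ i j, 0 < F.A i j → 0 < G.A (x i) (x j) := by
  obtain ⟨par, hlt, hpar⟩ := hF.exists_parent
  choose out hout using hout
  suffices h : ∀ n, ∃ x : Fin (m + 1) → V, x 0 = a ∧
      ∀ i : Fin (m + 1), i ≠ 0 → (i : ℕ) ≤ n → 0 < G.A (x (par i)) (x i) by
    obtain ⟨x, h0, h⟩ := h m
    refine ⟨x, h0, fun i j hij => ?_⟩
    obtain ⟨hj, rfl⟩ := (hpar j i).1 hij
    exact h j hj (by omega)
  intro n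
  induction n with
  | zero => exact ⟨fun _ => a, rfl, fun i hi h => absurd (Fin.ext (Nat.le_zero.1 h)) hi⟩
  | succ n ih =>
    obtain ⟨x, h0, hx⟩ := ih
    -- Parents precede children, so the image of the parent is already fixed and the new node
    -- follows an out-edge from it.
    refine ⟨fun i => if (i : ℕ) = n + 1 then out (x (par i)) else x i, by simp [h0], ?_⟩
    intro i hi hin
    have hp : (par i : ℕ) < i := hlt i hi
    have hp' : (par i : ℕ) ≠ n + 1 := by omega
    simp only [hp', if_false]
    split_ifs with h
    · exact hout _
    · exact hx i hi (by omega)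

end

end MotifSampling

/-- A telescoping product of ratios of a nonincreasing nonnegative sequence. -/
theorem prod_range_div_of_antitone {q : ℕ → ℝ} (hq : ∀ n, 0 ≤ q n) (hanti : Antitone q)
    (h0 : 0 < q 0) (n : ℕ) : ∏ i ∈ Finset.range n, q (i + 1) / q i = q n / q 0 := by
  induction n with
  | zero => simp [h0.ne']
  | succ n ih =>
    rw [Finset.prod_range_succ, ih]
    -- Once the sequence hits zero it stays there, so the convention `x / 0 = 0` does no harm.
    rcases (hq n).eq_or_lt with h | h
    · have : q (n + 1) = 0 := le_antisymm (h ▸ hanti n.le_succ) (hq _)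
      simp [this]
    · field_simp

namespace MotifSampling

section

variable {V : Type*} [Fintype V] {m : ℕ} {F H : Motif m} {G : Network V}

/-! ### The random walk kernel -/

theorem walkKernel_nonneg (G : Network V) (a b : V) : 0 ≤ walkKernel G a b := by
  have h : ∀ c, 0 ≤ G.α a * max (G.A a c) (G.A c a) * G.α c := fun c =>
    mul_nonneg (mul_nonneg (G.α_pos a).le (le_max_of_le_left (G.A_nonneg a c))) (G.α_pos c).le
  exact div_nonneg (h b) (Finset.sum_nonneg fun c _ => h c)

theorem walkKernel_pos_iff (G : Network V) (a b : V) :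
    0 < walkKernel G a b ↔ 0 < max (G.A a b) (G.A b a) := by
  have h : ∀ c, 0 ≤ G.α a * max (G.A a c) (G.A c a) * G.α c := fun c =>
    mul_nonneg (mul_nonneg (G.α_pos a).le (le_max_of_le_left (G.A_nonneg a c))) (G.α_pos c).le
  have hiff : 0 < G.α a * max (G.A a b) (G.A b a) * G.α b ↔ 0 < max (G.A a b) (G.A b a) := by
    rw [mul_pos_iff_of_pos_right (G.α_pos b), mul_pos_iff_of_pos_left (G.α_pos a)]
  rw [← hiff, walkKernel]
  constructor
  · intro hp
    refine lt_of_le_of_ne (h b) fun h0 => ?_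
    rw [← h0, zero_div] at hp
    exact lt_irrefl _ hp
  · intro hp
    exact div_pos hp (hp.trans_le (Finset.single_le_sum (fun c _ => h c) (Finset.mem_univ b)))

theorem walkKernel_pos_comm (G : Network V) (a b : V) :
    0 < walkKernel G a b ↔ 0 < walkKernel G b a := by
  rw [walkKernel_pos_iff, walkKernel_pos_iff, max_comm]

theorem sum_walkKernel (hout : G.HasOutEdges) (a : V) : ∑ b, walkKernel G a b = 1 := by
  obtain ⟨b, hb⟩ := hout a
  have hpos : 0 < walkKernel G a b :=
    (walkKernel_pos_iff G a b).2 (lt_max_of_lt_left hb)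
  simp only [walkKernel]
  rw [← Finset.sum_div]
  refine div_self fun h => ?_
  rw [walkKernel, h, div_zero] at hpos
  exact lt_irrefl _ hpos

theorem Network.IsIrreducible.reflTransGen [DecidableEq V] (hG : G.IsIrreducible) (a b : V) :
    Relation.ReflTransGen (fun a b => 0 < walkKernel G a b) a b := by
  obtain ⟨r, hr⟩ := hG a b
  induction r generalizing b with
  | zero =>
    rw [pow_zero, Matrix.one_apply] at hr
    split_ifs at hr with h
    · rw [h]
    · exact absurd hr (lt_irrefl _)
  | succ r ih =>
    rw [pow_succ, Matrix.mul_apply] at hr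
    obtain ⟨c, -, hc⟩ := Finset.exists_lt_of_sum_lt (s := Finset.univ) (f := fun _ => (0 : ℝ))
      (by simpa using hr)
    change 0 < (Matrix.of (walkKernel G) ^ r) a c * walkKernel G c b at hc
    have h2 : 0 < walkKernel G c b := by
      refine lt_of_le_of_ne (walkKernel_nonneg G c b) fun h0 => ?_
      rw [← h0, mul_zero] at hc
      exact lt_irrefl _ hc
    exact (ih c (pos_of_mul_pos_left hc h2.le)).tail h2

/-! ### The pivot chain -/

theorem homProbOf_nonneg (F : Motif m) (G : Network V) (E : Set (Fin (m + 1) → V)) :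
    0 ≤ homProbOf F G E :=
  Finset.sum_nonneg fun x _ => Set.indicator_nonneg (fun x _ => homProb_nonneg F G x) x

theorem homProbOf_mono (F : Motif m) (G : Network V) {E E' : Set (Fin (m + 1) → V)}
    (h : E ⊆ E') : homProbOf F G E ≤ homProbOf F G E' :=
  Finset.sum_le_sum fun x _ =>
    Set.indicator_le_indicator_of_subset h (fun x => homProb_nonneg F G x) x

theorem homProb_le_homProbOf {E : Set (Fin (m + 1) → V)} {x : Fin (m + 1) → V} (hx : x ∈ E) :
    homProb F G x ≤ homProbOf F G E := by
  rw [← Set.indicator_of_mem hx (homProb F G)]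
  exact Finset.single_le_sum
    (fun x _ => Set.indicator_nonneg (fun x _ => homProb_nonneg F G x) x) (Finset.mem_univ x)

theorem homProbOf_singleton (F : Motif m) (G : Network V) (y : Fin (m + 1) → V) :
    homProbOf F G {y} = homProb F G y := by
  rw [homProbOf, Finset.sum_eq_single y]
  · simp
  · intro z _ hz
    simp [hz]
  · simp

theorem pivotMarginal_pos (hF : F.IsRootedTree) (hout : G.HasOutEdges)
    (hpos : 0 < homDensity F G) (a : V) : 0 < pivotMarginal F G a := by
  obtain ⟨x, h0, hx⟩ := exists_hom_of_hasOutEdges hF hout a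
  exact lt_of_lt_of_le ((isHom_iff hpos x).2 hx) (homProb_le_homProbOf h0)

theorem sum_fiber_homProb [DecidableEq V] (F : Motif m) (G : Network V) (a : V) :
    (∑ y, if y 0 = a then homProb F G y else 0) = pivotMarginal F G a := by
  rw [pivotMarginal, homProbOf]
  refine Finset.sum_congr rfl fun y _ => ?_
  simp [Set.indicator_apply]

/-- Resampling all nodes but the root in turn draws from the law given the root. -/
theorem prod_nextNodeProb (y : Fin (m + 1) → V) (hpos : 0 < pivotMarginal F G (y 0)) :
    ∏ i ∈ Finset.univ.erase 0, nextNodeProb F G i y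
      = homProb F G y / pivotMarginal F G (y 0) := by
  -- The probability that nodes `0, …, n` agree with `y`; the conditional probabilities are its
  -- successive ratios.
  let q : ℕ → ℝ := fun n => homProbOf F G {z | ∀ j : Fin (m + 1), (j : ℕ) ≤ n → z j = y j}
  have hq0 : q 0 = pivotMarginal F G (y 0) := by
    simp only [q, pivotMarginal]
    congr 1
    ext z
    constructor
    · exact fun h => h 0 le_rfl
    · intro h j hj
      have : j = 0 := Fin.ext (Nat.le_zero.1 hj)
      rw [this]
      exact h
  have hqm : q m = homProb F G y := by
    rw [← homProbOf_singleton]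
    simp only [q]
    congr 1
    ext z
    constructor
    · exact fun h => funext fun j => h j (by omega)
    · rintro rfl j _
      rfl
  have hnext : ∀ i : Fin m, nextNodeProb F G i.succ y = q (i + 1) / q i := by
    intro i
    simp only [nextNodeProb, q]
    congr 3
    ext z
    simp only [Fin.lt_def, Fin.val_succ, Nat.lt_succ_iff]
  have hprod := prod_range_div_of_antitone (q := q) (fun n => homProbOf_nonneg _ _ _)
    (fun n n' h => homProbOf_mono _ _ fun z hz j hj => hz j (hj.trans h)) (hq0 ▸ hpos) m
  rw [hq0, hqm] at hprod
  rw [← hprod, Finset.prod_range, ← Finset.prod_congr rfl fun i _ => hnext i]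
  have : (Finset.univ.erase (0 : Fin (m + 1))) = Finset.univ.map (Fin.succEmb m) := by
    ext j
    simp [Fin.exists_succ_eq]
  rw [this, Finset.prod_map]
  rfl

theorem acceptProb_le_one (F : Motif m) (G : Network V) (a b : V) : acceptProb F G a b ≤ 1 :=
  min_le_right _ _

theorem acceptProb_nonneg (F : Motif m) (G : Network V) (a b : V) : 0 ≤ acceptProb F G a b :=
  le_min (mul_nonneg (div_nonneg (homProbOf_nonneg _ _ _) (homProbOf_nonneg _ _ _))
    (div_nonneg (walkKernel_nonneg _ _ _) (walkKernel_nonneg _ _ _))) zero_le_one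

/-- The Metropolis identity: the accepted flow is symmetric in `a` and `b`. The case Ψ(a,b) = 0 is
harmless because then Ψ(b,a) = 0 as well. -/
theorem flow_eq_min {a b : V} (ha : 0 < pivotMarginal F G a) :
    pivotMarginal F G a * (walkKernel G a b * acceptProb F G a b)
      = min (pivotMarginal F G b * walkKernel G b a) (pivotMarginal F G a * walkKernel G a b) := by
  rcases (walkKernel_nonneg G a b).eq_or_lt with h | h
  · have h' : walkKernel G b a = 0 := by
      by_contra hne
      have := (walkKernel_pos_comm G a b).2
        (lt_of_le_of_ne (walkKernel_nonneg G b a) (Ne.symm hne))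
      exact this.ne h
    simp [← h, h']
  · rw [acceptProb, ← mul_assoc, mul_min_of_nonneg _ _ (by positivity), mul_one]
    congr 1
    field_simp

variable [DecidableEq V]

theorem pivotMove_nonneg (F : Motif m) (G : Network V) (a b : V) : 0 ≤ pivotMove F G a b := by
  have h := fun c => mul_nonneg (walkKernel_nonneg G a c) (acceptProb_nonneg F G a c)
  have h' : ∀ c, 0 ≤ walkKernel G a c * (1 - acceptProb F G a c) := fun c =>
    mul_nonneg (walkKernel_nonneg G a c) (sub_nonneg.2 (acceptProb_le_one F G a c))
  rw [pivotMove]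
  refine add_nonneg (h b) ?_
  split_ifs
  · exact Finset.sum_nonneg fun c _ => h' c
  · exact le_rfl

theorem sum_pivotMove (hout : G.HasOutEdges) (a : V) : ∑ b, pivotMove F G a b = 1 := by
  simp only [pivotMove]
  rw [Finset.sum_add_distrib]
  simp only [Finset.sum_ite_eq', Finset.mem_univ, if_true, ← Finset.sum_add_distrib]
  refine (Finset.sum_congr rfl fun c _ => ?_).trans (sum_walkKernel hout a)
  ring

theorem pivotMove_detailed_balance (hpos : ∀ a, 0 < pivotMarginal F G a) (a b : V) :
    pivotMarginal F G a * pivotMove F G a b = pivotMarginal F G b * pivotMove F G b a := by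
  by_cases hab : b = a
  · rw [hab]
  · simp only [pivotMove, if_neg hab, if_neg (Ne.symm hab), add_zero]
    rw [flow_eq_min (hpos a), flow_eq_min (hpos b), min_comm]

theorem pivotMove_pos (hpos : ∀ a, 0 < pivotMarginal F G a) {a b : V}
    (hab : 0 < walkKernel G a b) : 0 < pivotMove F G a b := by
  have hba := (walkKernel_pos_comm G a b).1 hab
  rw [pivotMove]
  refine add_pos_of_pos_of_nonneg (mul_pos hab (lt_min ?_ one_pos)) ?_
  · exact mul_pos (div_pos (hpos b) (hpos a)) (div_pos hba hab)
  · split_ifs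
    · exact Finset.sum_nonneg fun c _ =>
        mul_nonneg (walkKernel_nonneg G a c) (sub_nonneg.2 (acceptProb_le_one F G a c))
    · exact le_rfl

/-- The kernel is the root move times the conditional law given the new root, so reversibility is
inherited from the root, and one positive Ψ-step reaches every homomorphism over the new root. -/
theorem pivotKernel_isReversibleErgodic (hF : F.IsRootedTree) (hG : G.IsIrreducible)
    (hout : G.HasOutEdges) (hpos : 0 < homDensity F G) :
    IsReversibleErgodic (pivotKernel F G) (homProb F G) := by
  have hm := pivotMarginal_pos hF hout hpos
  have hK : ∀ x y, pivotKernel F G x y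
      = pivotMove F G (x 0) (y 0) * (homProb F G y / pivotMarginal F G (y 0)) := fun x y => by
    rw [pivotKernel, prod_nextNodeProb y (hm _)]
  have hstep : ∀ x y, 0 < homProb F G y → 0 < walkKernel G (x 0) (y 0) →
      0 < pivotKernel F G x y := fun x y hy hxy => by
    rw [hK]
    exact mul_pos (pivotMove_pos hm hxy) (div_pos hy (hm _))
  refine ⟨homProb_nonneg F G, sum_homProb hpos, fun x y _ => ?_, fun x _ => ?_, fun x y => ?_,
    fun x y hx hy => ?_⟩
  · rw [hK]
    exact mul_nonneg (pivotMove_nonneg _ _ _ _) (div_nonneg (homProb_nonneg _ _ _) (hm _).le)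
  · rw [← sum_pivotMove (F := F) hout (x 0)]
    have h1 : ∀ y, pivotKernel F G x y = ∑ a, pivotMove F G (x 0) a / pivotMarginal F G a *
        (if y 0 = a then homProb F G y else 0) := fun y => by
      simp only [mul_ite, mul_zero, Finset.sum_ite_eq, Finset.mem_univ, if_true]
      rw [hK]
      ring
    simp only [h1]
    rw [Finset.sum_comm]
    refine Finset.sum_congr rfl fun a _ => ?_
    rw [← Finset.mul_sum, sum_fiber_homProb, div_mul_cancel₀ _ (hm a).ne']
  · rw [hK, hK]
    have := pivotMove_detailed_balance hm (x 0) (y 0)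
    have hx := hm (x 0)
    have hy := hm (y 0)
    field_simp
    linear_combination (homProb F G x * homProb F G y) * this
  -- At least one step is forced: even when `x` and `y` share their root, the other nodes must be
  -- resampled.
  · obtain ⟨c, hc⟩ := hout (x 0)
    have hxc : 0 < walkKernel G (x 0) c := (walkKernel_pos_iff _ _ _).2 (lt_max_of_lt_left hc)
    have key : ∀ a, Relation.ReflTransGen (fun a b => 0 < walkKernel G a b) c a →
        ∀ z : Fin (m + 1) → V, z 0 = a → 0 < homProb F G z →
        Relation.ReflTransGen (fun a b => 0 < pivotKernel F G a b) x z := by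
      intro a ha
      induction ha with
      | refl =>
        intro z hz hzp
        exact .single (hstep x z hzp (hz ▸ hxc))
      | @tail b d _ hbd ih =>
        intro z hz hzp
        obtain ⟨w, hw0, hw⟩ := exists_hom_of_hasOutEdges hF hout b
        have hwp : 0 < homProb F G w := (isHom_iff hpos w).2 hw
        exact (ih w hw0 hwp).tail (hstep w z hzp (by rw [hw0, hz]; exact hbd))
    exact key (y 0) (hG.reflTransGen c (y 0)) y rfl hy

end

end MotifSampling

/-! ### Reconfiguration of tree homomorphisms -/

section Reconfiguration

variable {V : Type*} {R : V → V → Prop} {par : ℕ → ℕ}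

/-- Two points joined by an `R`-walk of even length. -/
def EvenReach (R : V → V → Prop) : V → V → Prop :=
  Relation.ReflTransGen fun a c => ∃ b, R a b ∧ R b c

theorem EvenReach.swap (hR : ∀ a b, R a b → R b a) {a b : V} (h : EvenReach R a b) :
    EvenReach R b a := by
  induction h with
  | refl => exact .refl
  | tail _ hcd ih =>
    obtain ⟨d, hcd, hde⟩ := hcd
    exact Relation.ReflTransGen.head ⟨d, hR _ _ hde, hR _ _ hcd⟩ ih

/-- An edge followed by an even walk can be read as an even walk followed by an edge. -/
theorem EvenReach.shift {a b c : V} (hab : R a b) (hbc : EvenReach R b c) :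
    ∃ d, EvenReach R a d ∧ R d c := by
  induction hbc with
  | refl => exact ⟨a, .refl, hab⟩
  | tail _ hcd ih =>
    obtain ⟨d, had, hdc⟩ := ih
    obtain ⟨e, hce, hed⟩ := hcd
    exact ⟨e, had.tail ⟨_, hdc, hce⟩, hed⟩

theorem evenReach_of_walk {Γ : SimpleGraph V} (hΓ : ∀ a b, Γ.Adj a b → R a b) {a b : V}
    (p : Γ.Walk a b) :
    (Even p.length → EvenReach R a b) ∧ (Odd p.length → ∃ c, R a c ∧ EvenReach R c b) := by
  induction p with
  | nil => exact ⟨fun _ => .refl, fun h => by simp at h⟩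
  | @cons a c b hac p ih =>
    rw [SimpleGraph.Walk.length_cons]
    refine ⟨fun h => ?_, fun h => ⟨c, hΓ _ _ hac, ih.1 ?_⟩⟩
    · obtain ⟨d, hcd, hdb⟩ := ih.2 (by
        rw [← Nat.not_even_iff_odd]
        exact fun h' => (Nat.even_add_one.1 h) h')
      exact Relation.ReflTransGen.head ⟨c, hΓ _ _ hac, hcd⟩ hdb
    · rw [← Nat.not_odd_iff_even]
      exact fun h' => (Nat.odd_add_one.1 h) h'

/-- In a connected structure with an odd closed walk, any two points are joined by an even walk. -/
theorem evenReach_of_odd (hR : ∀ a b, R a b → R b a)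
    (hconn : ∀ a b, Relation.ReflTransGen R a b) {v w : V} (hvw : R v w)
    (hwv : EvenReach R w v) (a b : V) : EvenReach R a b := by
  -- Each edge leading away from `v` spoils the parity, and a turn around the odd closed walk
  -- through `v` and `w` restores it.
  have key : ∀ u, EvenReach R u v := by
    intro u
    induction hconn v u with
    | refl => exact .refl
    | @tail u u' _ huu' ih =>
      obtain ⟨d, hd, hdv⟩ := EvenReach.shift (hR _ _ huu') ih
      exact (hd.tail ⟨v, hdv, hvw⟩).trans hwv
  exact (key a).trans ((key b).swap hR)

/-- `x` maps the edges of the tree on `0, …, n` with parent function `par` into `R`. -/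
def TreeHom (R : V → V → Prop) (par : ℕ → ℕ) (n : ℕ) (x : ℕ → V) : Prop :=
  ∀ i, i ≠ 0 → i ≤ n → R (x (par i)) (x i)

/-- Two tree homomorphisms that differ in at most one node. -/
def TreeMove (R : V → V → Prop) (par : ℕ → ℕ) (n : ℕ) (x y : ℕ → V) : Prop :=
  TreeHom R par n x ∧ TreeHom R par n y ∧ ∃ i ≤ n, ∀ j ≤ n, j ≠ i → x j = y j

theorem TreeHom.update (hpar : ∀ i, i ≠ 0 → par i < i) {n : ℕ} {x : ℕ → V} {c : V}
    (hx : TreeHom R par n x) (hc : R (x (par (n + 1))) c) :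
    TreeHom R par (n + 1) (Function.update x (n + 1) c) := by
  intro i hi hin
  have hlt := hpar i hi
  rw [Function.update_of_ne (show par i ≠ n + 1 by omega)]
  rcases eq_or_ne i (n + 1) with rfl | hne
  · rwa [Function.update_self]
  · rw [Function.update_of_ne hne]
    exact hx i hi (by omega)

theorem treeMove_update (hpar : ∀ i, i ≠ 0 → par i < i) {n : ℕ} {x : ℕ → V} {c d : V}
    (hx : TreeHom R par n x) (hc : R (x (par (n + 1))) c) (hd : R (x (par (n + 1))) d) :
    TreeMove R par (n + 1) (Function.update x (n + 1) c) (Function.update x (n + 1) d) :=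
  ⟨hx.update hpar hc, hx.update hpar hd, n + 1, le_rfl, fun j _ hj => by
    rw [Function.update_of_ne hj, Function.update_of_ne hj]⟩

/-- Moves on the tree without its last leaf can be lifted to the tree. -/
theorem TreeMove.lift (hR : ∀ a b, R a b → R b a) (hpar : ∀ i, i ≠ 0 → par i < i) {n : ℕ}
    (hn : n ≠ 0) {x y : ℕ → V} (h : TreeMove R par n x y) {c : V}
    (hc : R (x (par (n + 1))) c) :
    ∃ d, R (y (par (n + 1))) d ∧ Relation.ReflTransGen (TreeMove R par (n + 1))
      (Function.update x (n + 1) c) (Function.update y (n + 1) d) := by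
  obtain ⟨hx, hy, i, hi, hxy⟩ := h
  have hp := hpar (n + 1) (by omega)
  have hmove : ∀ d, R (x (par (n + 1))) d → R (y (par (n + 1))) d →
      TreeMove R par (n + 1) (Function.update x (n + 1) d) (Function.update y (n + 1) d) := by
    intro d hxd hyd
    refine ⟨hx.update hpar hxd, hy.update hpar hyd, i, by omega, fun j hj hji => ?_⟩
    rcases eq_or_ne j (n + 1) with rfl | hne
    · rw [Function.update_self, Function.update_self]
    · rw [Function.update_of_ne hne, Function.update_of_ne hne]
      exact hxy j (by omega) hji
  by_cases hpi : par (n + 1) = i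
  -- The parent of the leaf moves, so the leaf needs a common neighbour of its old and new images.
  -- The image of another tree neighbour `w` of the parent serves, since `w` stays put: node 1 if
  -- the parent is the root, the grandparent otherwise.
  · obtain ⟨w, hwn, hwi, hw⟩ : ∃ w ≤ n, w ≠ i ∧
        ∀ z, TreeHom R par n z → R (z (par (n + 1))) (z w) := by
      by_cases hp0 : par (n + 1) = 0
      · refine ⟨1, by omega, by omega, fun z hz => ?_⟩
        have h1 := hz 1 one_ne_zero (by omega)
        have h0 : par 1 = 0 := by
          have := hpar 1 one_ne_zero
          omega
        rwa [hp0, ← h0]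
      · have hpp := hpar _ hp0
        exact ⟨par (par (n + 1)), by omega, by omega, fun z hz => hR _ _ (hz _ hp0 (by omega))⟩
    have hyd : R (y (par (n + 1))) (x w) := by
      rw [hxy w hwn hwi]
      exact hw y hy
    exact ⟨x w, hyd, (Relation.ReflTransGen.single (treeMove_update hpar hx hc (hw x hx))).tail
      (hmove _ (hw x hx) hyd)⟩
  · have : R (y (par (n + 1))) c := by
      rwa [← hxy _ (by omega) hpi]
    exact ⟨c, this, .single (hmove c hc this)⟩

/-- Any two tree homomorphisms are joined by moves at single nodes. -/
theorem treeMove_connected (hR : ∀ a b, R a b → R b a) (hpar : ∀ i, i ≠ 0 → par i < i)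
    (heven : ∀ a b, EvenReach R a b) (n : ℕ) (x y : ℕ → V) (hx : TreeHom R par n x)
    (hy : TreeHom R par n y) : Relation.ReflTransGen (TreeMove R par n) x y := by
  induction n generalizing x y with
  | zero => exact .single ⟨hx, hy, 0, le_rfl, fun j hj hj0 => absurd (Nat.le_zero.1 hj) hj0⟩
  | succ n ih =>
    rcases Nat.eq_zero_or_pos n with rfl | hn
    · have h0 : par 1 = 0 := by
        have := hpar 1 one_ne_zero
        omega
      have hiff : ∀ z : ℕ → V, TreeHom R par (0 + 1) z ↔ R (z 0) (z 1) := by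
        intro z
        refine ⟨fun h => h0 ▸ h 1 one_ne_zero le_rfl, fun h i hi hi1 => ?_⟩
        have : i = 1 := by omega
        rwa [this, h0]
      -- On a single edge, the root goes from `b` to `c` by first sending the leaf to a common
      -- neighbour `e`. This is the only use of even walks.
      have key : ∀ a, EvenReach R (x 0) a →
          ∃ z, z 0 = a ∧ R (z 0) (z 1) ∧
            Relation.ReflTransGen (TreeMove R par (0 + 1)) x z := by
        intro a ha
        induction ha with
        | refl => exact ⟨x, rfl, (hiff x).1 hx, .refl⟩
        | @tail b c _ hbc ih' =>
          obtain ⟨z, rfl, hz, hxz⟩ := ih'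
          obtain ⟨e, hbe, hec⟩ := hbc
          let u : ℕ → V := Function.update z 1 e
          have hu0 : u 0 = z 0 := Function.update_of_ne (by omega) _ _
          have hu1 : u 1 = e := Function.update_self _ _ _
          let u' : ℕ → V := Function.update u 0 c
          have hu'0 : u' 0 = c := Function.update_self _ _ _
          have hu'1 : u' 1 = e := (Function.update_of_ne (by omega) _ _).trans hu1
          have hu : R (u 0) (u 1) := by rwa [hu0, hu1]
          have hu' : R (u' 0) (u' 1) := by
            rw [hu'0, hu'1]
            exact hR _ _ hec
          refine ⟨u', hu'0, hu', (hxz.tail ⟨(hiff _).2 hz, (hiff _).2 hu, 1, le_rfl, ?_⟩).tail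
            ⟨(hiff _).2 hu, (hiff _).2 hu', 0, Nat.zero_le _, ?_⟩⟩
          · intro j _ hj1
            exact (Function.update_of_ne hj1 _ _).symm
          · intro j _ hj0
            exact (Function.update_of_ne hj0 _ _).symm
      obtain ⟨z, hz0, hz, hxz⟩ := key (y 0) (heven _ _)
      refine hxz.tail ⟨(hiff z).2 hz, hy, 1, le_rfl, fun j hj hj1 => ?_⟩
      have : j = 0 := by omega
      rw [this, hz0]
    · have hx' : TreeHom R par n x := fun i hi hin => hx i hi (by omega)
      have hy' : TreeHom R par n y := fun i hi hin => hy i hi (by omega)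
      -- The path on the smaller tree is lifted move by move with some image of the last leaf; a
      -- final move corrects that leaf.
      have key : ∀ z, Relation.ReflTransGen (TreeMove R par n) x z →
          ∃ d, R (z (par (n + 1))) d ∧ Relation.ReflTransGen (TreeMove R par (n + 1))
            x (Function.update z (n + 1) d) := by
        intro z hxz
        induction hxz with
        | refl =>
          refine ⟨x (n + 1), hx (n + 1) (by omega) le_rfl, ?_⟩
          rw [Function.update_eq_self]
        | tail _ hbc ih' =>
          obtain ⟨c, hc, hxc⟩ := ih'
          obtain ⟨d, hd, hcd⟩ := hbc.lift hR hpar hn.ne' hc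
          exact ⟨d, hd, hxc.trans hcd⟩
      obtain ⟨d, hd, hxd⟩ := key y (ih x y hx' hy')
      have := treeMove_update hpar hy' hd (hy (n + 1) (by omega) le_rfl)
      rw [Function.update_eq_self] at this
      exact hxd.tail this

end Reconfiguration

theorem prod_prod_eq_erase {ι M : Type*} [Fintype ι] [DecidableEq ι] [CommMonoid M]
    (f : ι → ι → M) (i : ι) :
    ∏ a, ∏ b, f a b = (∏ a ∈ Finset.univ.erase i, ∏ b ∈ Finset.univ.erase i, f a b) *
      ((∏ j ∈ Finset.univ.erase i, f j i * f i j) * f i i) := by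
  have h : ∀ a, ∏ b, f a b = f a i * ∏ b ∈ Finset.univ.erase i, f a b := fun a =>
    (Finset.mul_prod_erase _ _ (Finset.mem_univ i)).symm
  rw [← Finset.mul_prod_erase _ _ (Finset.mem_univ i), h i]
  simp only [h, Finset.prod_mul_distrib]
  rw [mul_left_comm, mul_assoc, mul_right_comm, mul_comm (∏ a ∈ _, ∏ b ∈ _, f a b)]
  ac_rfl

namespace MotifSampling

section

variable {V : Type*} [Fintype V] {m : ℕ} {F H : Motif m} {G : Network V}

/-! ### The Glauber chain -/

theorem glauberWeight_nonneg (F : Motif m) (G : Network V) (x : Fin (m + 1) → V)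
    (i : Fin (m + 1)) (b : V) : 0 ≤ glauberWeight F G x i b :=
  mul_nonneg (mul_nonneg (Finset.prod_nonneg fun _ _ => mul_nonneg
    (Real.rpow_nonneg (G.A_nonneg _ _) _) (Real.rpow_nonneg (G.A_nonneg _ _) _))
    (Real.rpow_nonneg (G.A_nonneg _ _) _)) (G.α_pos b).le

theorem glauberWeight_congr {x y : Fin (m + 1) → V} {i : Fin (m + 1)}
    (h : ∀ j, j ≠ i → y j = x j) : glauberWeight F G y i = glauberWeight F G x i := by
  funext b
  simp only [glauberWeight]
  congr 2
  refine Finset.prod_congr rfl fun j hj => ?_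
  rw [h j (Finset.ne_of_mem_erase hj)]

/-- The part of the weight of a vertex map that does not involve the image of node `i`. -/
noncomputable def restWeight (F : Motif m) (G : Network V) (x : Fin (m + 1) → V) (i : Fin (m + 1)) : ℝ :=
  (∏ a ∈ Finset.univ.erase i, ∏ b ∈ Finset.univ.erase i, G.A (x a) (x b) ^ F.A a b) *
    ∏ a ∈ Finset.univ.erase i, G.α (x a)

theorem restWeight_congr {x y : Fin (m + 1) → V} {i : Fin (m + 1)}
    (h : ∀ j, j ≠ i → y j = x j) : restWeight F G y i = restWeight F G x i := by
  simp only [restWeight]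
  congr 1
  · refine Finset.prod_congr rfl fun a ha => Finset.prod_congr rfl fun b hb => ?_
    rw [h a (Finset.ne_of_mem_erase ha), h b (Finset.ne_of_mem_erase hb)]
  · refine Finset.prod_congr rfl fun a ha => ?_
    rw [h a (Finset.ne_of_mem_erase ha)]

/-- As a function of the image of node `i` alone, π is proportional to the Glauber weight; detailed
balance rests on this. -/
theorem homProb_eq_restWeight_mul (F : Motif m) (G : Network V) (x : Fin (m + 1) → V)
    (i : Fin (m + 1)) :
    homProb F G x = restWeight F G x i * glauberWeight F G x i (x i) / homDensity F G := by
  rw [homProb, edgeProd, prod_prod_eq_erase _ i, restWeight, glauberWeight,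
    ← Finset.mul_prod_erase _ _ (Finset.mem_univ i)]
  ring

theorem IsHom.glauberWeight_pos {x : Fin (m + 1) → V} (hx : IsHom F G x) (i : Fin (m + 1)) :
    0 < glauberWeight F G x i (x i) := by
  refine lt_of_le_of_ne (glauberWeight_nonneg _ _ _ _ _) fun h => ?_
  rw [IsHom, homProb_eq_restWeight_mul F G x i, ← h] at hx
  simp at hx

theorem IsHom.sum_glauberWeight_pos {x : Fin (m + 1) → V} (hx : IsHom F G x) (i : Fin (m + 1)) :
    0 < ∑ c, glauberWeight F G x i c :=
  (hx.glauberWeight_pos i).trans_le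
    (Finset.single_le_sum (fun c _ => glauberWeight_nonneg F G x i c) (Finset.mem_univ (x i)))

variable [DecidableEq V]

theorem glauberKernel_detailed_balance (F : Motif m) (G : Network V) (x y : Fin (m + 1) → V) :
    homProb F G x * glauberKernel F G x y = homProb F G y * glauberKernel F G y x := by
  simp only [glauberKernel, Finset.mul_sum]
  refine Finset.sum_congr rfl fun i _ => ?_
  by_cases h : ∀ j, j ≠ i → y j = x j
  · rw [if_pos h, if_pos fun j hj => (h j hj).symm, homProb_eq_restWeight_mul F G x i,
      homProb_eq_restWeight_mul F G y i, glauberWeight_congr h, restWeight_congr h]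
    ring
  · rw [if_neg h, if_neg fun h' => h fun j hj => (h' j hj).symm]
    simp

theorem glauberKernel_summand_nonneg (F : Motif m) (G : Network V) (x y : Fin (m + 1) → V)
    (i : Fin (m + 1)) : 0 ≤ (1 / ((m : ℝ) + 1)) * if ∀ j, j ≠ i → y j = x j then
      glauberWeight F G x i (y i) / ∑ c, glauberWeight F G x i c else 0 := by
  refine mul_nonneg (by positivity) ?_
  split_ifs
  · exact div_nonneg (glauberWeight_nonneg _ _ _ _ _)
      (Finset.sum_nonneg fun c _ => glauberWeight_nonneg _ _ _ _ _)
  · exact le_rfl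

theorem glauberKernel_pos {x y : Fin (m + 1) → V} (hx : IsHom F G x) (hy : IsHom F G y)
    {i : Fin (m + 1)} (h : ∀ j, j ≠ i → y j = x j) : 0 < glauberKernel F G x y := by
  refine Finset.sum_pos' (fun i _ => glauberKernel_summand_nonneg F G x y i)
    ⟨i, Finset.mem_univ i, ?_⟩
  rw [if_pos h, ← glauberWeight_congr h]
  exact mul_pos (by positivity) (div_pos (hy.glauberWeight_pos i) (hy.sum_glauberWeight_pos i))

theorem sum_glauberKernel {x : Fin (m + 1) → V} (hx : IsHom F G x) :
    ∑ y, glauberKernel F G x y = 1 := by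
  simp only [glauberKernel]
  rw [Finset.sum_comm]
  have h : ∀ i, ∑ y : Fin (m + 1) → V, (1 / ((m : ℝ) + 1)) * (if ∀ j, j ≠ i → y j = x j then
      glauberWeight F G x i (y i) / ∑ c, glauberWeight F G x i c else 0) = 1 / ((m : ℝ) + 1) := by
    intro i
    rw [← Finset.mul_sum, ← Finset.sum_filter]
    have himg : (Finset.univ.filter fun y : Fin (m + 1) → V => ∀ j, j ≠ i → y j = x j)
        = Finset.univ.image fun b => Function.update x i b := by
      ext y
      simp only [Finset.mem_filter, Finset.mem_univ, true_and, Finset.mem_image]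
      constructor
      · intro hy
        refine ⟨y i, funext fun j => ?_⟩
        rcases eq_or_ne j i with rfl | hj
        · rw [Function.update_self]
        · rw [Function.update_of_ne hj, hy j hj]
      · rintro ⟨b, rfl⟩ j hj
        exact Function.update_of_ne hj _ _
    rw [himg, Finset.sum_image fun a _ b _ hab => Function.update_injective x i hab]
    simp only [Function.update_self]
    rw [← Finset.sum_div, div_self (hx.sum_glauberWeight_pos i).ne', mul_one]
  simp only [h]
  rw [Finset.sum_const, Finset.card_univ, Fintype.card_fin, nsmul_eq_mul]
  push_cast
  field_simp

/-- Connectivity is the reconfiguration theorem for the relation of positive weight: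
bidirectionality makes it symmetric, irreducibility connected, and the odd cycle supplies the odd
closed walk. -/
theorem glauberKernel_isReversibleErgodic (hF : F.IsRootedTree) (hG : G.IsIrreducible)
    (hbi : G.IsBidirectional)
    (hodd : ∃ (v : V) (c : G.skeleton.Walk v v), c.IsCycle ∧ Odd c.length)
    (hpos : 0 < homDensity F G) :
    IsReversibleErgodic (glauberKernel F G) (homProb F G) := by
  refine ⟨homProb_nonneg F G, sum_homProb hpos, fun x y _ => Finset.sum_nonneg fun i _ =>
    glauberKernel_summand_nonneg F G x y i, fun _ => sum_glauberKernel,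
    glauberKernel_detailed_balance F G, fun x y hx hy => ?_⟩
  obtain ⟨par, hlt, hpar⟩ := hF.exists_parent
  let R : V → V → Prop := fun a b => 0 < G.A a b
  have hR : ∀ a b, R a b → R b a := fun a b => (hbi a b).1
  have hconn : ∀ a b, Relation.ReflTransGen R a b := fun a b =>
    Relation.ReflTransGen.mono (fun a b hab => by
      rcases lt_max_iff.1 ((walkKernel_pos_iff G a b).1 hab) with h | h
      · exact h
      · exact hR _ _ h) _ _ (hG.reflTransGen a b)
  obtain ⟨v, c, -, hc⟩ := hodd
  obtain ⟨w, hvw, hwv⟩ := (evenReach_of_walk (R := R)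
    (fun _ _ hab => (lt_min_iff.1 (And.right hab)).1) c).2 hc
  have heven := evenReach_of_odd hR hconn hvw hwv
  -- Clamping translates between nodes in `Fin (m + 1)` and the ℕ-indexed trees of the
  -- reconfiguration argument; indices beyond `m` are irrelevant.
  let e : ℕ → Fin (m + 1) := fun i => ⟨min i m, by omega⟩
  have he : ∀ i : Fin (m + 1), e i = i := fun i => Fin.ext (min_eq_left (by omega))
  have he' : ∀ i, i ≤ m → ((e i : Fin (m + 1)) : ℕ) = i := fun i hi => min_eq_left hi
  let par' : ℕ → ℕ := fun i => if i ≤ m then par (e i) else 0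
  have hpar' : ∀ i, i ≠ 0 → par' i < i := by
    intro i hi
    simp only [par']
    split_ifs with him
    · have h1 := hlt (e i) fun h => hi (by rw [← he' i him, h]; rfl)
      rw [Fin.lt_def, he' i him] at h1
      exact h1
    · omega
  have hparv : ∀ i : Fin (m + 1), par' i = par i := fun i => by
    simp only [par']
    rw [if_pos (by omega), he]
  have hom_iff : ∀ z : ℕ → V, TreeHom R par' m z ↔ IsHom F G fun i => z i := by
    intro z
    rw [isHom_iff hpos]
    constructor
    · intro h i j hij
      obtain ⟨hj, rfl⟩ := (hpar j i).1 hij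
      rw [← hparv]
      exact h j (fun h0 => hj (Fin.ext h0)) (by omega)
    · intro h i hi him
      have h1 := h (par (e i)) (e i) ((hpar _ _).2 ⟨fun h0 => hi (by rw [← he' i him, h0]; rfl), rfl⟩)
      simp only [he' i him] at h1
      simp only [par', if_pos him]
      exact h1
  have ext_eq : ∀ z : Fin (m + 1) → V, (fun i : Fin (m + 1) => (fun n => z (e n)) (i : ℕ)) = z :=
    fun z => funext fun i => congrArg z (he i)
  have hpath := treeMove_connected hR hpar' heven m (fun n => x (e n)) (fun n => y (e n))
    ((hom_iff _).2 (by rw [ext_eq]; exact hx)) ((hom_iff _).2 (by rw [ext_eq]; exact hy))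
  have := Relation.ReflTransGen.lift (p := fun a b => 0 < glauberKernel F G a b)
    (fun (z : ℕ → V) (i : Fin (m + 1)) => z i) (fun z z' hzz => ?_) _ _ hpath
  · rw [Function.onFun, ext_eq, ext_eq] at this
    exact this
  · obtain ⟨hz, hz', i, hi, hne⟩ := hzz
    refine glauberKernel_pos ((hom_iff _).1 hz) ((hom_iff _).1 hz') (i := ⟨i, by omega⟩)
      fun j hj => ?_
    exact (hne j (by omega) fun h => hj (Fin.ext h)).symm

end

end MotifSampling

theorem mainTheorem9 {V : Type*} [Fintype V] [DecidableEq V] {m : ℕ}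
    (F H : Motif m) (hF : F.IsRootedTree)
    (G : Network V) (hG : G.IsIrreducible)
    (x₀ : Fin (m + 1) → V) (hx₀ : IsHom F G x₀)
    {Ω : Type*} [MeasurableSpace Ω] (μ : Measure Ω) [IsProbabilityMeasure μ]
    (X : ℕ → Ω → Fin (m + 1) → V) :
    (G.HasOutEdges → IsMarkovChain μ (pivotKernel F G) x₀ X →
      ∀ᵐ ω ∂μ, TimeAveragesConverge F H G (fun t => X t ω)) ∧
    (G.IsBidirectional → (∃ (v : V) (c : G.skeleton.Walk v v), c.IsCycle ∧ Odd c.length) →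
      IsMarkovChain μ (glauberKernel F G) x₀ X →
      ∀ᵐ ω ∂μ, TimeAveragesConverge F H G (fun t => X t ω)) := by
  have hpos := hx₀.homDensity_pos
  constructor
  · intro hout hX
    filter_upwards [hX.ae_tendsto_average
      (pivotKernel_isReversibleErgodic hF hG hout hpos) hx₀] with ω hω
    exact timeAveragesConverge_of_tendsto H hω
  · intro hbi hodd hX
    filter_upwards [hX.ae_tendsto_average
      (glauberKernel_isReversibleErgodic hF hG hbi hodd hpos) hx₀] with ω hω
    exact timeAveragesConverge_of_tendsto H hω
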